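/- Conventions. Let $\Gamma$ be a ring; $\mathrm{mod}\text{-}\Gamma$ denotes the category of finitely generated right $\Gamma$-modules, and $\mathrm{add}(U)$ denotes the class of direct summands of finite direct sums of copies of $U$. For $n\ge 0$, a module $K\in\mathrm{mod}\text{-}\Gamma$ is an $n$-syzygy if there are $X\in\mathrm{mod}\text{-}\Gamma$ and an exact sequence $0\to K\to P_{n-1}\to\cdots\to P_0\to X\to 0$ with all $P_i$ finitely generated projective (for $n=0$: $K\cong X$). For integers $m,n\ge 0$, $\Gamma$ is an $(m,n)$-Igusa–Todorov algebra if there is $U\in\mathrm{mod}\text{-}\Gamma$ such that for every $n$-syzygy $K$ there is an exact sequence $0\to U_m\to\cdots\to U_1\to U_0\to K\to 0$ with all $U_i\in\mathrm{add}(U)$. $\Gamma$ is an Igusa–Todorov algebra if it is a $(1,n)$-Igusa–Todorov algebra for some $n\ge 0$. $\Gamma$ is syzygy-finite if for some $n\ge 0$ there are, up to isomorphism, only finitely many indecomposable modules that are direct summands of $n$-syzygies. The Igusa–Todorov distance is $$\mathrm{IT}(\Gamma)=\inf\{m\ge 0 \mid \Gamma \text{ is an } (m,n)\text{-Igusa–Todorov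 algebra for some } n\ge 0\}\in\mathbb N\cup\{\infty\}.$$ Corollary 1.3. Let $\Lambda$ be an Artin algebra, that is, an algebra over a commutative Artinian ring $k$ that is finitely generated as a $k$-module, and let $e=e^2\in\Lambda$ be an idempotent. Put $\mathrm{gl.dim}_{\Lambda/\Lambda e\Lambda}\Lambda=\sup\{\mathrm{pd}\,X_\Lambda \mid X\in \mathrm{mod}\text{-}\Lambda/\Lambda e\Lambda\}$. Assume that $e\Lambda$ is a projective left $e\Lambda e$-module. Then the following statements hold, for all integers $m,n,r,s\ge 0$. 1. Assume that $\Lambda/\Lambda e\Lambda$ is an $(m,r)$-Igusa–Todorov algebra and $e\Lambda e$ is an $(n,s)$-Igusa–Todorov algebra. If $\Lambda e\Lambda$ is a projective right $\Lambda$-module, then $\Lambda$ is a $(2m+n+2,\max\{r,s\})$-Igusa–Todorov algebra. 2. Assume that $\Lambda/\Lambda e\Lambda$ is an $(m,r)$-Igusa–Todorov algebra and $e\Lambda e$ is an $(n,s)$-Igusa–Todorov algebra. If $\Lambda/\Lambda e\Lambda$ is a projective left $\Lambda$-module and $\Lambda e\Lambda$ is a projective right $\Lambda$-module, then $\Lambda$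 is an $(m+n+1,\max\{r,s\})$-Igusa–Todorov algebra. 3. Assume that $\Lambda/\Lambda e\Lambda$ and $e\Lambda e$ are syzygy-finite algebras. If $\Lambda/\Lambda e\Lambda$ is a projective left $\Lambda$-module and $\Lambda e\Lambda$ is a projective right $\Lambda$-module, then $\Lambda$ is an Igusa–Todorov algebra. 4. If $\mathrm{gl.dim}_{\Lambda/\Lambda e\Lambda}\Lambda<\infty$, then $\mathrm{IT}(e\Lambda e)\le\mathrm{IT}(\Lambda)\le\mathrm{IT}(e\Lambda e)+2$. If moreover $\Lambda/\Lambda e\Lambda$ is a projective left $\Lambda$-module, then $\mathrm{IT}(e\Lambda e)\le\mathrm{IT}(\Lambda)\le\mathrm{IT}(e\Lambda e)+1$. 5. If $\Lambda e\Lambda$ is a projective right $\Lambda$-module, then $\mathrm{IT}(e\Lambda e)\le\mathrm{IT}(\Lambda)\le 2\,\mathrm{IT}(\Lambda/\Lambda e\Lambda)+\mathrm{IT}(e\Lambda e)+2$. If moreover $\Lambda/\Lambda e\Lambda$ is a projective left $\Lambda$-module, then $\mathrm{IT}(e\Lambda e)\le\mathrm{IT}(\Lambda)\le\mathrm{IT}(\Lambda/\Lambda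 e\Lambda)+\mathrm{IT}(e\Lambda e)+1$. -/

import Mathlib

universe u

/-!
All module-theoretic notions below are written for left modules over a ring `R`. A right module
over a ring `Γ` is a module over `Γᵐᵒᵖ`, so the category of finitely generated right `Γ`-modules is
obtained by taking `R = Γᵐᵒᵖ`.
-/

/-- An exact sequence `0 ⟶ V n ⟶ ⋯ ⟶ V 1 ⟶ V 0 ⟶ X ⟶ 0` of `R`-modules with all `V i` finitely
generated. The sequence is continued by zero to the left of `V n`, so that exactness at `V n` is
the injectivity of its outgoing map (for `n = 0` this says that `ε : V 0 ⟶ X` is bijective). -/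
structure FGExactSeq (R : Type u) [Ring R] (n : ℕ) (X : ModuleCat.{u} R) where
  /-- the terms -/
  V : ℕ → ModuleCat.{u} R
  /-- the maps between the terms -/
  d : ∀ i, V (i + 1) →ₗ[R] V i
  /-- the last map -/
  ε : V 0 →ₗ[R] X
  finite : ∀ i, Module.Finite R (V i)
  zero : ∀ i, n < i → Subsingleton (V i)
  exact_succ : ∀ i, Function.Exact (d (i + 1)) (d i)
  exact_zero : Function.Exact (d 0) ε
  surjective : Function.Surjective ε

/-- `M` lies in `add U`: it is a direct summand of a finite direct sum of copies of `U`. -/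
def InAdd {R : Type u} [Ring R] (U M : ModuleCat.{u} R) : Prop :=
  ∃ (k : ℕ) (N : ModuleCat.{u} R), Nonempty ((M × N) ≃ₗ[R] (Fin k → U))

/-- `K` is an `n`-syzygy of `X`: there is an exact sequence
`0 ⟶ K ⟶ P (n - 1) ⟶ ⋯ ⟶ P 0 ⟶ X ⟶ 0` with all `P i` finitely generated projective.
For `n = 0` this means `K ≅ X`. -/
def IsSyzygyOf {R : Type u} [Ring R] (n : ℕ) (K X : ModuleCat.{u} R) : Prop :=
  ∃ S : FGExactSeq R n X, (∀ i, i < n → Module.Projective R (S.V i)) ∧ Nonempty (K ≃ₗ[R] S.V n)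

/-- `K` is an `n`-syzygy in the category of finitely generated `R`-modules. -/
def IsSyzygy {R : Type u} [Ring R] (n : ℕ) (K : ModuleCat.{u} R) : Prop :=
  Module.Finite R K ∧ ∃ X : ModuleCat.{u} R, Module.Finite R X ∧ IsSyzygyOf n K X

/-- The category of finitely generated `R`-modules is an `(m, n)`-Igusa–Todorov category. -/
def IsITCat (R : Type u) [Ring R] (m n : ℕ) : Prop :=
  ∃ U : ModuleCat.{u} R, Module.Finite R U ∧
    ∀ K : ModuleCat.{u} R, IsSyzygy n K →
      ∃ S : FGExactSeq R m K, ∀ i, i ≤ m → InAdd U (S.V i)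

/-- `Γ` is an `(m, n)`-Igusa–Todorov algebra (right modules). -/
def IsITAlgebra (Γ : Type u) [Ring Γ] (m n : ℕ) : Prop := IsITCat Γᵐᵒᵖ m n

/-- `Γ` is an Igusa–Todorov algebra: for some `n`, there is a finitely generated right module `U`
such that every `n`-syzygy `K` admits an exact sequence `0 ⟶ U₁ ⟶ U₀ ⟶ K ⟶ 0` with
`U₀, U₁ ∈ add U`. -/
def IsIgusaTodorov (Γ : Type u) [Ring Γ] : Prop := ∃ n : ℕ, IsITAlgebra Γ 1 n

/-- The Igusa–Todorov distance of `Γ`: the infimum of all `m` such that `Γ` is an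
`(m, n)`-Igusa–Todorov algebra for some `n` (and `⊤` if there is no such `m`). -/
noncomputable def ITDist (Γ : Type u) [Ring Γ] : ℕ∞ :=
  ⨅ (m : ℕ) (_ : ∃ n : ℕ, IsITAlgebra Γ m n), (m : ℕ∞)

/-- `Γ` is `n`-syzygy-finite: up to isomorphism there are only finitely many indecomposable right
modules which are direct summands of `n`-syzygies of finitely generated right modules. -/
def IsSyzygyFiniteAt (Γ : Type u) [Ring Γ] (n : ℕ) : Prop :=
  ∃ (k : ℕ) (L : Fin k → ModuleCat.{u} Γᵐᵒᵖ),
    ∀ M : ModuleCat.{u} Γᵐᵒᵖ, CategoryTheory.Indecomposable M →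
      (∃ K N : ModuleCat.{u} Γᵐᵒᵖ, IsSyzygy n K ∧ Nonempty ((M × N) ≃ₗ[Γᵐᵒᵖ] K)) →
        ∃ j, Nonempty (M ≃ₗ[Γᵐᵒᵖ] L j)

/-- `Γ` is syzygy-finite: it is `n`-syzygy-finite for some `n`. -/
def IsSyzygyFinite (Γ : Type u) [Ring Γ] : Prop := ∃ n : ℕ, IsSyzygyFiniteAt Γ n

section Idempotent

variable {Λ : Type u} [Ring Λ]

/-- The two-sided ideal `ΛeΛ`, with its structure of a left and of a right `Λ`-module. -/
abbrev idemIdeal (e : Λ) : TwoSidedIdeal Λ := TwoSidedIdeal.span {e}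

/-- The quotient ring `Λ/ΛeΛ`, which is also a left `Λ`-module. -/
abbrev IdemQuot (e : Λ) : Type u := Λ ⧸ (idemIdeal e).asIdeal

/-- The underlying additive group `{e * x | x ∈ Λ}` of `eΛ`. -/
def IdemRight (e : Λ) : Type u := (AddMonoidHom.mulLeft e).range

instance (e : Λ) : AddCommGroup (IdemRight e) :=
  inferInstanceAs (AddCommGroup (AddMonoidHom.mulLeft e).range)

/-- `eΛ` as a left module over the corner ring `eΛe`, acting by multiplication in `Λ`. -/
instance {e : Λ} (he : IsIdempotentElem e) : Module he.Corner (IdemRight e) where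
  smul a x := ⟨a.1 * x.1, a.1 * x.1, by
    rw [AddMonoidHom.coe_mulLeft, ← mul_assoc, ((Subsemigroup.mem_corner_iff he).1 a.2).1]⟩
  one_smul x := Subtype.ext <| by
    obtain ⟨_, y, rfl⟩ := x
    change e * (e * y) = e * y
    rw [← mul_assoc, he.eq]
  mul_smul a b x := Subtype.ext (mul_assoc a.1 b.1 x.1)
  smul_zero a := Subtype.ext (mul_zero a.1)
  smul_add a x y := Subtype.ext (mul_add a.1 x.1 y.1)
  add_smul a b x := Subtype.ext (add_mul a.1 b.1 x.1)
  zero_smul x := Subtype.ext (zero_mul x.1)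

/-- The relative global dimension `gl.dim_{Λ/ΛeΛ} Λ`: the supremum of the projective dimensions of
the right `Λ`-modules `X`, where `X` runs through the finitely generated right
`Λ/ΛeΛ`-modules. -/
noncomputable def relGlobalDim (e : Λ) : WithBot ℕ∞ :=
  ⨆ (X : ModuleCat.{u} (IdemQuot e)ᵐᵒᵖ) (_ : Module.Finite (IdemQuot e)ᵐᵒᵖ X),
    CategoryTheory.projectiveDimension
      ((ModuleCat.restrictScalars
        (RingHom.op (Ideal.Quotient.mk (idemIdeal e).asIdeal))).obj X)

end Idempotent

/-! Write R, S, T for the opposite rings of Λ, eΛe, Λ/ΛeΛ, and ε for e viewed in R. Since eΛ is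
finitely generated projective over eΛe, the induction Y ↦ Rε ⊗ Y from S to R is exact and preserves
finitely generated projectives; M ↦ εM is exact, and ε(Rε ⊗ Y) ≅ Y. Inducing a syzygy from S,
resolving it over R and applying ε shows that the Igusa–Todorov property descends to the corner
(`CornerData.isITCat_corner`), whence all the lower bounds.

The upper bounds come from the counit Rε ⊗ εX ⟶ X, whose kernel and cokernel are killed by ε and so
are T-modules; its source is controlled by S (`exists_hasRes_induced`). If RεR is projective, the
counit is injective on submodules of finitely generated projectives; if Λ/ΛeΛ is left projective,
RεR has a left unit and the counit is injective on every X. Taking j-th syzygies of 0 → Rε ⊗ εX → X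
→ X/RεX → 0 (`SyzOf.horseshoe`) presents a j-th syzygy of X, up to a projective, as an extension of
C by Y, where Y has a resolution of length n and C is a j-th syzygy of a T-module. For projective
RεR, syzygies over R and over T can be compared (`exists_syzOf_quotient`), so an (n+1)-st syzygy of
C has a resolution of length m, and `HasRes.extension` splices the two into one of length m + n + 1.
When the counit is injective only on first syzygies, one more step is paid (`isITCat_of_succ`).

If the relative global dimension is finite, high R-syzygies of the kernel and cokernel of the counit
are projective. The cokernel then splits off and the kernel costs one step, so n + 1 suffices with
no projectivity assumption on ΛeΛ or Λ/ΛeΛ (`isITCat_of_projective_syzygy`). -/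

/-! ### Short exact sequences -/

section ShortExact

variable {R : Type u} [Ring R]
variable {A B C D K L M N P Q X Y : Type u}
variable [AddCommGroup A] [Module R A] [AddCommGroup B] [Module R B] [AddCommGroup C] [Module R C]
variable [AddCommGroup D] [Module R D] [AddCommGroup K] [Module R K] [AddCommGroup L] [Module R L]
variable [AddCommGroup M] [Module R M] [AddCommGroup N] [Module R N] [AddCommGroup P] [Module R P]
variable [AddCommGroup Q] [Module R Q] [AddCommGroup X] [Module R X] [AddCommGroup Y] [Module R Y]

/-- There is a short exact sequence `0 ⟶ A ⟶ B ⟶ C ⟶ 0` of `R`-modules. -/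
def IsExt (R : Type u) [Ring R] (A B C : Type u) [AddCommGroup A] [Module R A] [AddCommGroup B]
    [Module R B] [AddCommGroup C] [Module R C] : Prop :=
  ∃ (f : A →ₗ[R] B) (g : B →ₗ[R] C),
    Function.Injective f ∧ Function.Exact f g ∧ Function.Surjective g

theorem exists_lift_of_exact {f : A →ₗ[R] B} {g : B →ₗ[R] C} (hf : Function.Injective f)
    (hfg : Function.Exact f g) (h : D →ₗ[R] B) (hh : ∀ x, g (h x) = 0) :
    ∃ a : D →ₗ[R] A, ∀ x, f (a x) = h x := by
  refine ⟨(LinearEquiv.ofInjective f hf).symm.toLinearMap ∘ₗ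
    h.codRestrict (LinearMap.range f) (fun x => (hfg (h x)).1 (hh x)), fun x => ?_⟩
  have := (LinearEquiv.ofInjective f hf).apply_symm_apply
    (h.codRestrict (LinearMap.range f) (fun x => (hfg (h x)).1 (hh x)) x)
  exact congrArg Subtype.val this

theorem isExt_ker (g : B →ₗ[R] C) (hg : Function.Surjective g) :
    IsExt R (LinearMap.ker g) B C :=
  ⟨(LinearMap.ker g).subtype, g, Subtype.val_injective, fun y => by simp, hg⟩

theorem isExt_prod (A B : Type u) [AddCommGroup A] [Module R A] [AddCommGroup B] [Module R B] :
    IsExt R A (A × B) B :=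
  ⟨LinearMap.inl R A B, LinearMap.snd R A B, LinearMap.inl_injective, fun y => by
    constructor
    · intro h
      exact ⟨y.1, Prod.ext rfl h.symm⟩
    · rintro ⟨x, rfl⟩
      rfl, LinearMap.snd_surjective⟩

theorem isExt_self_punit (A : Type u) [AddCommGroup A] [Module R A] :
    IsExt R PUnit.{u + 1} A A :=
  ⟨0, LinearMap.id, fun _ _ _ => Subsingleton.elim _ _, fun y => by
    simp [eq_comm], Function.surjective_id⟩

namespace IsExt

theorem congr (h : IsExt R A B C) (a : A ≃ₗ[R] D) (b : B ≃ₗ[R] K) (c : C ≃ₗ[R] L) :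
    IsExt R D K L := by
  obtain ⟨f, g, hf, hfg, hg⟩ := h
  refine ⟨b.toLinearMap ∘ₗ f ∘ₗ a.symm.toLinearMap, c.toLinearMap ∘ₗ g ∘ₗ b.symm.toLinearMap,
    ?_, ?_, ?_⟩
  · simpa using hf
  · intro y
    simp only [LinearMap.comp_apply, LinearEquiv.coe_coe, Set.mem_range,
      LinearEquiv.map_eq_zero_iff]
    rw [hfg]
    constructor
    · rintro ⟨x, hx⟩
      exact ⟨a x, by simp [hx]⟩
    · rintro ⟨x, rfl⟩
      exact ⟨a.symm x, by simp⟩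
  · simpa using hg

theorem prod (h : IsExt R A B C) (h' : IsExt R D K L) : IsExt R (A × D) (B × K) (C × L) := by
  obtain ⟨f, g, hf, hfg, hg⟩ := h
  obtain ⟨f', g', hf', hfg', hg'⟩ := h'
  refine ⟨f.prodMap f', g.prodMap g', hf.prodMap hf', ?_, hg.prodMap hg'⟩
  rintro ⟨y, z⟩
  simp only [LinearMap.prodMap_apply, Prod.mk_eq_zero, Set.mem_range, Prod.exists, Prod.mk.injEq]
  rw [hfg, hfg']
  constructor
  · rintro ⟨⟨a, ha⟩, b, hb⟩
    exact ⟨a, b, ha, hb⟩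
  · rintro ⟨a, b, ha, hb⟩
    exact ⟨⟨a, ha⟩, b, hb⟩

/-- The pullback of B ⟶ C ⟵ P surjects onto P with kernel A, hence is A × P because P is projective;
projecting it onto B has kernel D. This is the basic move for syzygies and resolutions below. -/
theorem rotate [Module.Projective R P] (h : IsExt R A B C) (h' : IsExt R D P C) :
    IsExt R D (A × P) B := by
  obtain ⟨f, g, hf, hfg, hg⟩ := h
  obtain ⟨i, p, hi, hip, hp⟩ := h'
  obtain ⟨s, hs⟩ := Module.projective_lifting_property g p hg
  replace hs : ∀ x, g (s x) = p x := fun x => LinearMap.congr_fun hs x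
  obtain ⟨a, ha⟩ := exists_lift_of_exact hf hfg (s ∘ₗ i) (fun x => by
    simpa [hs] using hip.apply_apply_eq_zero x)
  refine ⟨(-a).prod i, f.coprod s, ?_, ?_, ?_⟩
  · intro x y hxy
    exact hi (congrArg Prod.snd hxy)
  · rintro ⟨y, z⟩
    constructor
    · intro h0
      replace h0 : f y + s z = 0 := h0
      have : p z = 0 := by
        have := congrArg g h0
        rwa [map_add, hfg.apply_apply_eq_zero, hs, map_zero, zero_add] at this
      obtain ⟨x, rfl⟩ := (hip z).1 this
      refine ⟨x, Prod.ext (hf ?_) rfl⟩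
      change f (-a x) = f y
      rw [map_neg, ha]
      exact (eq_neg_of_add_eq_zero_left h0).symm
    · rintro ⟨x, hx⟩
      rw [← hx]
      change f (-a x) + s (i x) = 0
      rw [map_neg, ha]
      exact neg_add_cancel _
  · intro b
    obtain ⟨z, hz⟩ := hp (g b)
    obtain ⟨y, hy⟩ := (hfg (b - s z)).1 (by rw [map_sub, hs, hz, sub_self])
    exact ⟨(y, z), by simp [hy]⟩

theorem nonempty_equiv_prod [Module.Projective R C] (h : IsExt R A B C) :
    Nonempty (B ≃ₗ[R] A × C) := by
  obtain ⟨f, g, hf, hg, hgs⟩ := h.rotate (isExt_self_punit C)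
  refine ⟨(LinearEquiv.ofBijective g ⟨?_, hgs⟩).symm⟩
  rw [injective_iff_map_eq_zero]
  intro x hx
  obtain ⟨y, rfl⟩ := (hg x).1 hx
  rw [Subsingleton.elim y 0, map_zero]

theorem equiv_of_subsingleton_left [Subsingleton A] (h : IsExt R A B C) :
    Nonempty (B ≃ₗ[R] C) := by
  obtain ⟨f, g, hf, hg, hgs⟩ := h
  refine ⟨LinearEquiv.ofBijective g ⟨?_, hgs⟩⟩
  rw [injective_iff_map_eq_zero]
  intro x hx
  obtain ⟨y, rfl⟩ := (hg x).1 hx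
  rw [Subsingleton.elim y 0, map_zero]

/-- The kernel of a composition of two surjections. -/
theorem comp (h : IsExt R K M N) (h' : IsExt R L N Q) :
    ∃ E : ModuleCat.{u} R, IsExt R E M Q ∧ IsExt R K E L := by
  obtain ⟨f, g, hf, hfg, hg⟩ := h
  obtain ⟨i, p, hi, hip, hp⟩ := h'
  refine ⟨ModuleCat.of R (LinearMap.ker (p ∘ₗ g)), isExt_ker _ (hp.comp hg), ?_⟩
  have hE : ∀ x : LinearMap.ker (p ∘ₗ g), p (g x) = 0 := fun x => x.2
  obtain ⟨a, ha⟩ := exists_lift_of_exact hi hip (g ∘ₗ (LinearMap.ker (p ∘ₗ g)).subtype) hE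
  replace ha : ∀ x : LinearMap.ker (p ∘ₗ g), i (a x) = g x := ha
  refine ⟨f.codRestrict _ (fun x => ?_), a, ?_, ?_, ?_⟩
  · rw [LinearMap.mem_ker, LinearMap.comp_apply, hfg.apply_apply_eq_zero, map_zero]
  · intro x y hxy
    exact hf (congrArg Subtype.val hxy)
  · intro y
    rw [← hi.eq_iff, ha, map_zero, hfg]
    constructor
    · rintro ⟨x, hx⟩
      exact ⟨x, Subtype.ext hx⟩
    · rintro ⟨x, hx⟩
      exact ⟨x, congrArg Subtype.val hx⟩
  · intro l
    obtain ⟨m, hm⟩ := hg (i l)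
    refine ⟨⟨m, ?_⟩, hi ?_⟩
    · rw [LinearMap.mem_ker, LinearMap.comp_apply, hm, hip.apply_apply_eq_zero]
    · rw [ha, hm]

theorem finite_left [IsNoetherianRing R] [Module.Finite R B] (h : IsExt R A B C) :
    Module.Finite R A := by
  obtain ⟨f, g, hf, -, -⟩ := h
  exact Module.Finite.of_injective f hf

theorem finite_right [Module.Finite R B] (h : IsExt R A B C) : Module.Finite R C := by
  obtain ⟨f, g, -, -, hg⟩ := h
  exact Module.Finite.of_surjective g hg

end IsExt

end ShortExact

/-! ### Iterated syzygies and the horseshoe construction -/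

section Syzygy

variable {R : Type u} [Ring R]

/-- `K` is an `n`-th syzygy of `X` with respect to finitely generated projective modules, defined
by iterating the formation of a single syzygy. -/
def SyzOf (R : Type u) [Ring R] : ℕ → (K X : Type u) → [AddCommGroup K] → [Module R K] →
    [AddCommGroup X] → [Module R X] → Prop
  | 0, K, X, _, _, _, _ => Nonempty (K ≃ₗ[R] X)
  | n + 1, K, X, _, _, _, _ => ∃ P X' : ModuleCat.{u} R, Module.Finite R P ∧
      Module.Projective R P ∧ IsExt R X' P X ∧ SyzOf R n K X'

variable {A B C K L M P X Y : Type u}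
variable [AddCommGroup A] [Module R A] [AddCommGroup B] [Module R B] [AddCommGroup C] [Module R C]
variable [AddCommGroup K] [Module R K] [AddCommGroup L] [Module R L]
variable [AddCommGroup M] [Module R M] [AddCommGroup P] [Module R P]
variable [AddCommGroup X] [Module R X] [AddCommGroup Y] [Module R Y]

theorem exists_isExt_projective [IsNoetherianRing R] (X : Type u) [AddCommGroup X] [Module R X]
    [Module.Finite R X] : ∃ P K : ModuleCat.{u} R, Module.Finite R P ∧ Module.Projective R P ∧
      Module.Finite R K ∧ IsExt R K P X := by
  obtain ⟨n, f, hf⟩ := Module.Finite.exists_fin' R X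
  exact ⟨ModuleCat.of R (Fin n → R), ModuleCat.of R (LinearMap.ker f),
    inferInstanceAs (Module.Finite R (Fin n → R)),
    inferInstanceAs (Module.Projective R (Fin n → R)),
    inferInstanceAs (Module.Finite R (LinearMap.ker f)), isExt_ker f hf⟩

theorem exists_syzOf [IsNoetherianRing R] (n : ℕ) : ∀ (X : Type u) [AddCommGroup X] [Module R X]
    [Module.Finite R X], ∃ K : ModuleCat.{u} R, Module.Finite R K ∧ SyzOf R n K X := by
  induction n with
  | zero =>
    intro X _ _ hX
    exact ⟨ModuleCat.of R X, hX, ⟨LinearEquiv.refl R X⟩⟩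
  | succ n ih =>
    intro X _ _ _
    obtain ⟨P, X', hP, hP', hX', hE⟩ := exists_isExt_projective (R := R) X
    obtain ⟨K, hK, hS⟩ := ih X'
    exact ⟨K, hK, P, X', hP, hP', hE, hS⟩

namespace SyzOf

theorem congr {n : ℕ} {K L X Y : Type u} [AddCommGroup K] [Module R K] [AddCommGroup L]
    [Module R L] [AddCommGroup X] [Module R X] [AddCommGroup Y] [Module R Y]
    (h : SyzOf R n K X) (a : K ≃ₗ[R] L) (b : X ≃ₗ[R] Y) : SyzOf R n L Y := by
  induction n generalizing X Y with
  | zero =>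
    obtain ⟨c⟩ := h
    exact ⟨(a.symm.trans c).trans b⟩
  | succ n ih =>
    obtain ⟨P, X', hP, hP', hE, hS⟩ := h
    exact ⟨P, X', hP, hP', hE.congr (.refl R _) (.refl R _) b, ih hS (.refl R _)⟩

theorem prod_projective [Module.Finite R P] [Module.Projective R P] {n : ℕ} {X : Type u}
    [AddCommGroup X] [Module R X]
    (h : SyzOf R n K X) : SyzOf R n (K × P) (X × P) := by
  induction n generalizing X with
  | zero =>
    obtain ⟨c⟩ := h
    exact ⟨c.prodCongr (.refl R P)⟩
  | succ n ih =>
    obtain ⟨Q, X', hP, hP', hE, hS⟩ := h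
    exact ⟨ModuleCat.of R (Q × (P × P)), ModuleCat.of R (X' × P),
      inferInstanceAs (Module.Finite R (Q × (P × P))),
      inferInstanceAs (Module.Projective R (Q × (P × P))), hE.prod (isExt_prod P P), ih hS⟩

theorem trans {m n : ℕ} {X : Type u} [AddCommGroup X] [Module R X]
    (h : SyzOf R m L X) (h' : SyzOf R n K L) : SyzOf R (m + n) K X := by
  induction m generalizing X with
  | zero =>
    obtain ⟨c⟩ := h
    rw [zero_add]
    exact h'.congr (.refl R K) c
  | succ m ih =>
    obtain ⟨P, X', hP, hP', hE, hS⟩ := h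
    rw [Nat.add_right_comm]
    exact ⟨P, X', hP, hP', hE, ih hS⟩

theorem exists_of_add {m n : ℕ} {X : Type u} [AddCommGroup X] [Module R X]
    (h : SyzOf R (m + n) K X) : ∃ L : ModuleCat.{u} R, SyzOf R m L X ∧ SyzOf R n K L := by
  induction m generalizing X with
  | zero =>
    rw [zero_add] at h
    exact ⟨ModuleCat.of R X, ⟨.refl R X⟩, h⟩
  | succ m ih =>
    rw [Nat.succ_add_eq_add_succ] at h
    obtain ⟨P, X', hP, hP', hE, hS⟩ := h
    obtain ⟨L, h1, h2⟩ := ih hS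
    exact ⟨L, ⟨P, X', hP, hP', hE, h1⟩, h2⟩

theorem finite [IsNoetherianRing R] {n : ℕ} {X : Type u} [AddCommGroup X] [Module R X]
    [Module.Finite R X] (h : SyzOf R n K X) : Module.Finite R K := by
  induction n generalizing X with
  | zero =>
    obtain ⟨c⟩ := h
    exact Module.Finite.equiv c.symm
  | succ n ih =>
    obtain ⟨P, X', hP, hP', hE, hS⟩ := h
    have := hE.finite_left
    exact ih hS

theorem punit_succ (n : ℕ) (X : Type u) [AddCommGroup X] [Module R X] [Module.Finite R X]
    [Module.Projective R X] : SyzOf R (n + 1) PUnit.{u + 1} X := by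
  induction n generalizing X with
  | zero =>
    exact ⟨ModuleCat.of R X, ModuleCat.of R PUnit.{u + 1}, inferInstanceAs (Module.Finite R X),
      inferInstanceAs (Module.Projective R X), isExt_self_punit X, ⟨.refl R _⟩⟩
  | succ n ih =>
    exact ⟨ModuleCat.of R X, ModuleCat.of R PUnit.{u + 1}, inferInstanceAs (Module.Finite R X),
      inferInstanceAs (Module.Projective R X), isExt_self_punit X, ih PUnit.{u + 1}⟩

/-- Syzygies of the outer terms of a short exact sequence, adapted to a given syzygy of the middle
term and a given syzygy of the left term. -/
theorem horseshoe {n : ℕ} {A' A B C K : Type u} [AddCommGroup A] [Module R A] [AddCommGroup B]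
    [Module R B] [AddCommGroup C] [Module R C] [AddCommGroup K] [Module R K] [AddCommGroup A']
    [Module R A'] (h : IsExt R A B C) (hA : SyzOf R n A' A) (hK : SyzOf R n K B) :
    ∃ C' P : ModuleCat.{u} R, Module.Finite R P ∧ Module.Projective R P ∧ SyzOf R n C' C ∧
      IsExt R A' (K × P) C' := by
  induction n generalizing A B C K with
  | zero =>
    obtain ⟨a⟩ := hA
    obtain ⟨b⟩ := hK
    exact ⟨ModuleCat.of R C, ModuleCat.of R PUnit.{u + 1},
      inferInstanceAs (Module.Finite R PUnit.{u + 1}),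
      inferInstanceAs (Module.Projective R PUnit.{u + 1}), ⟨.refl R _⟩,
      h.congr a.symm (b.symm.trans LinearEquiv.prodUnique.symm) (.refl R _)⟩
  | succ n ih =>
    obtain ⟨Q, A₁, hQ, hQ', hEA, hSA⟩ := hA
    obtain ⟨P, K₁, hP, hP', hEK, hSK⟩ := hK
    -- The kernel C₁ of P ⟶ B ⟶ C is an extension of A by K₁. Rotating it against the cover Q of A
    -- gives 0 → A₁ → K₁ × Q → C₁ → 0, which is the same situation one syzygy further.
    obtain ⟨C₁, hC₁, hE₁⟩ := hEK.comp h
    obtain ⟨C', P', h1, h2, h3, h4⟩ := ih (hE₁.rotate hEA) hSA (hSK.prod_projective (P := Q))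
    exact ⟨C', ModuleCat.of R (Q × P'), inferInstanceAs (Module.Finite R (Q × P')),
      inferInstanceAs (Module.Projective R (Q × P')), ⟨P, C₁, hP, hP', hC₁, h3⟩,
      h4.congr (.refl R _) (LinearEquiv.prodAssoc R _ _ _) (.refl R _)⟩

end SyzOf

end Syzygy

/-! ### The additive closure, through factorizations of the identity -/

section AddClosure

variable {R : Type u} [Ring R]

/-- The additive group of all sums of `R`-linear maps `M ⟶ N` which factor through `U`. -/
def sumsThrough (R : Type u) [Ring R] (U M N : Type u) [AddCommGroup U] [Module R U]
    [AddCommGroup M] [Module R M] [AddCommGroup N] [Module R N] : AddSubgroup (M →ₗ[R] N) :=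
  AddSubgroup.closure {h | ∃ (f : M →ₗ[R] U) (g : U →ₗ[R] N), h = g ∘ₗ f}

/-- `M` is a direct summand of a finite direct sum of copies of `U`, expressed by factorizations of
the identity. -/
def MemAdd (R : Type u) [Ring R] (U M : Type u) [AddCommGroup U] [Module R U]
    [AddCommGroup M] [Module R M] : Prop :=
  LinearMap.id ∈ sumsThrough R U M M

variable {M N U V W : Type u} [AddCommGroup U] [Module R U]
    [AddCommGroup M] [Module R M] [AddCommGroup N] [Module R N]
    [AddCommGroup V] [Module R V] [AddCommGroup W] [Module R W]

theorem comp_mem_sumsThrough (f : M →ₗ[R] U) (g : U →ₗ[R] N) : g ∘ₗ f ∈ sumsThrough R U M N :=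
  AddSubgroup.subset_closure ⟨f, g, rfl⟩

theorem comp_mem_sumsThrough_of_mem {h : V →ₗ[R] W} (hh : h ∈ sumsThrough R U V W)
    (f : M →ₗ[R] V) (g : W →ₗ[R] N) : g ∘ₗ h ∘ₗ f ∈ sumsThrough R U M N := by
  induction hh using AddSubgroup.closure_induction with
  | mem x hx =>
    obtain ⟨a, b, rfl⟩ := hx
    exact comp_mem_sumsThrough (a ∘ₗ f) (g ∘ₗ b)
  | zero => simp
  | add x y _ _ hx hy =>
    rw [LinearMap.add_comp, LinearMap.comp_add]
    exact add_mem hx hy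
  | neg x _ hx =>
    rw [LinearMap.neg_comp, LinearMap.comp_neg]
    exact neg_mem hx

theorem MemAdd.sumsThrough_le (h : MemAdd R U V) : sumsThrough R V M N ≤ sumsThrough R U M N := by
  rw [sumsThrough, AddSubgroup.closure_le]
  rintro _ ⟨f, g, rfl⟩
  exact comp_mem_sumsThrough_of_mem h f g

theorem mem_sumsThrough_iff {h : M →ₗ[R] N} : h ∈ sumsThrough R U M N ↔
    ∃ (k : ℕ) (f : M →ₗ[R] (Fin k → U)) (g : (Fin k → U) →ₗ[R] N), g ∘ₗ f = h := by
  constructor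
  · intro hh
    -- Arbitrary finite index types let a sum of two maps be indexed by a disjoint union; reindexing
    -- by `Fin k` is done once at the end.
    have key : ∃ (ι : Type) (_ : Fintype ι) (f : ι → M →ₗ[R] U) (g : ι → U →ₗ[R] N),
        ∑ i, g i ∘ₗ f i = h := by
      induction hh using AddSubgroup.closure_induction with
      | mem x hx =>
        obtain ⟨a, b, rfl⟩ := hx
        exact ⟨Unit, inferInstance, fun _ => a, fun _ => b, by simp⟩
      | zero => exact ⟨Empty, inferInstance, Empty.elim, Empty.elim, by simp⟩
      | add x y _ _ hx hy =>
        obtain ⟨ι, _, f, g, rfl⟩ := hx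
        obtain ⟨κ, _, f', g', rfl⟩ := hy
        exact ⟨ι ⊕ κ, inferInstance, Sum.elim f f', Sum.elim g g', by simp⟩
      | neg x _ hx =>
        obtain ⟨ι, _, f, g, rfl⟩ := hx
        exact ⟨ι, inferInstance, f, fun i => - g i, by simp [LinearMap.neg_comp]⟩
    obtain ⟨ι, _, f, g, rfl⟩ := key
    let t := (Fintype.equivFin ι).symm
    refine ⟨Fintype.card ι, LinearMap.pi fun i => f (t i),
      LinearMap.lsum R (fun _ => U) ℕ fun i => g (t i), ?_⟩
    ext x
    simp only [LinearMap.comp_apply, LinearMap.lsum_apply, LinearMap.sum_apply,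
      LinearMap.proj_apply, LinearMap.pi_apply]
    exact t.sum_comp fun i => g i (f i x)
  · rintro ⟨k, f, g, rfl⟩
    have : g ∘ₗ f = ∑ i, (g ∘ₗ LinearMap.single R (fun _ => U) i) ∘ₗ (LinearMap.proj i ∘ₗ f) := by
      ext x
      simp only [LinearMap.comp_apply, LinearMap.sum_apply, LinearMap.proj_apply]
      rw [← map_sum]
      congr 1
      exact (LinearMap.sum_single_apply (φ := fun _ => U) (f x)).symm
    rw [this]
    exact sum_mem fun i _ => comp_mem_sumsThrough _ _

namespace MemAdd

theorem refl (U : Type u) [AddCommGroup U] [Module R U] : MemAdd R U U :=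
  comp_mem_sumsThrough LinearMap.id LinearMap.id

theorem trans (h : MemAdd R U V) (h' : MemAdd R V W) : MemAdd R U W :=
  h.sumsThrough_le h'

theorem of_retract (h : MemAdd R U V) (i : M →ₗ[R] V) (p : V →ₗ[R] M)
    (hp : p ∘ₗ i = LinearMap.id) : MemAdd R U M := by
  have := comp_mem_sumsThrough_of_mem h i p
  rwa [LinearMap.id_comp, hp] at this

theorem of_equiv (h : MemAdd R U V) (a : V ≃ₗ[R] M) : MemAdd R U M :=
  h.of_retract a.symm.toLinearMap a.toLinearMap (by ext; simp)

theorem of_subsingleton [Subsingleton M] : MemAdd R U M := by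
  have : (LinearMap.id : M →ₗ[R] M) = 0 := Subsingleton.elim _ _
  rw [MemAdd, this]
  exact zero_mem _

theorem prod (h : MemAdd R U V) (h' : MemAdd R U W) : MemAdd R U (V × W) := by
  have h1 := comp_mem_sumsThrough_of_mem h (LinearMap.fst R V W) (LinearMap.inl R V W)
  have h2 := comp_mem_sumsThrough_of_mem h' (LinearMap.snd R V W) (LinearMap.inr R V W)
  have := add_mem h1 h2
  rw [LinearMap.id_comp, LinearMap.id_comp] at this
  have hid : (LinearMap.id : V × W →ₗ[R] V × W) = LinearMap.inl R V W ∘ₗ LinearMap.fst R V W +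
      LinearMap.inr R V W ∘ₗ LinearMap.snd R V W := by
    ext x <;> simp
  rw [MemAdd, hid]
  exact this

theorem fst_of_prod (h : MemAdd R U (V × W)) : MemAdd R U V :=
  h.of_retract (LinearMap.inl R V W) (LinearMap.fst R V W) (by ext; simp)

theorem snd_of_prod (h : MemAdd R U (V × W)) : MemAdd R U W :=
  h.of_retract (LinearMap.inr R V W) (LinearMap.snd R V W) (by ext; simp)

theorem pi {ι : Type} [Fintype ι] {V : ι → Type u} [∀ i, AddCommGroup (V i)] [∀ i, Module R (V i)]
    (h : ∀ i, MemAdd R U (V i)) : MemAdd R U (∀ i, V i) := by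
  classical
  have : (LinearMap.id : (∀ i, V i) →ₗ[R] _) = ∑ i, LinearMap.single R V i ∘ₗ LinearMap.id ∘ₗ
      LinearMap.proj i := by
    refine LinearMap.ext fun x => ?_
    rw [LinearMap.sum_apply]
    exact (LinearMap.sum_single_apply (φ := V) x).symm
  rw [MemAdd, this]
  exact sum_mem fun i _ => comp_mem_sumsThrough_of_mem (h i) _ _

theorem nonempty_equiv_of_retract (f : M →ₗ[R] V) (g : V →ₗ[R] M) (h : g ∘ₗ f = LinearMap.id) :
    Nonempty ((M × LinearMap.ker g) ≃ₗ[R] V) := by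
  replace h : ∀ x, g (f x) = x := LinearMap.congr_fun h
  refine ⟨LinearEquiv.ofBijective (f.coprod (LinearMap.ker g).subtype) ⟨?_, fun v => ?_⟩⟩
  · rw [injective_iff_map_eq_zero]
    rintro ⟨x, y, hy⟩ hxy
    replace hxy : f x + y = 0 := hxy
    obtain rfl : x = 0 := by
      rw [← h x, eq_neg_of_add_eq_zero_left hxy, map_neg, LinearMap.mem_ker.1 hy, neg_zero]
    rw [map_zero, zero_add] at hxy
    exact Prod.ext rfl (Subtype.ext hxy)
  · exact ⟨(g v, ⟨v - f (g v), by simp [h]⟩), by simp⟩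

theorem iff_inAdd {U M : ModuleCat.{u} R} : MemAdd R U M ↔ InAdd U M := by
  constructor
  · intro h
    obtain ⟨k, f, g, hfg⟩ := mem_sumsThrough_iff.1 h
    exact ⟨k, ModuleCat.of R (LinearMap.ker g), nonempty_equiv_of_retract f g hfg⟩
  · rintro ⟨k, N, ⟨a⟩⟩
    exact fst_of_prod (W := N) ((pi fun _ : Fin k => refl (R := R) U).of_equiv a.symm)

theorem finite [Module.Finite R U] (h : MemAdd R U M) : Module.Finite R M := by
  obtain ⟨k, f, g, hfg⟩ := mem_sumsThrough_iff.1 h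
  exact Module.Finite.of_surjective g fun x => ⟨f x, LinearMap.congr_fun hfg x⟩

theorem projective [Module.Projective R U] (h : MemAdd R U M) : Module.Projective R M := by
  obtain ⟨k, f, g, hfg⟩ := mem_sumsThrough_iff.1 h
  have := Module.Projective.of_equiv' (R := R) (DFinsupp.linearEquivFunOnFintype (M := fun _ : Fin k => U))
  exact Module.Projective.of_split f g hfg

theorem of_projective [Module.Finite R M] [Module.Projective R M] : MemAdd R R M := by
  obtain ⟨n, f, hf⟩ := Module.Finite.exists_fin' R M
  obtain ⟨s, hs⟩ := Module.projective_lifting_property f LinearMap.id hf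
  exact (pi fun _ : Fin n => refl (R := R) R).of_retract s f hs

/-- The additive closure of a module is carried by syzygies into the additive closure of a syzygy
together with the regular module. -/
theorem syzygy {P Q K L : Type u} [AddCommGroup P] [Module R P] [AddCommGroup Q] [Module R Q]
    [AddCommGroup K] [Module R K] [AddCommGroup L] [Module R L] [Module.Projective R P]
    [Module.Finite R Q] [Module.Projective R Q] (h : MemAdd R U V) (hU : IsExt R L P U)
    (hV : IsExt R K Q V) : MemAdd R (L × R) K := by
  obtain ⟨i, p, hi, hip, hp⟩ := hU
  obtain ⟨j, q, hj, hjq, hq⟩ := hV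
  have hL : MemAdd R (L × R) L := (refl (R := R) (L × R)).fst_of_prod
  have hQ : MemAdd R (L × R) Q := (refl (R := R) (L × R)).snd_of_prod.trans of_projective
  -- Every endomorphism a of V that factors through sums of copies of U lifts to b on the cover Q,
  -- and the map c induced by b on K factors through syzygies of U.
  have key : ∀ a ∈ sumsThrough R U V V, ∃ b : Q →ₗ[R] Q, ∃ c ∈ sumsThrough R (L × R) K K,
      (∀ x, q (b x) = a (q x)) ∧ ∀ x, b (j x) = j (c x) := by
    intro a ha
    induction ha using AddSubgroup.closure_induction with
    | mem x hx =>
      obtain ⟨f, g, rfl⟩ := hx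
      obtain ⟨f₁, hf₁⟩ := Module.projective_lifting_property p (f ∘ₗ q) hp
      obtain ⟨g₁, hg₁⟩ := Module.projective_lifting_property q (g ∘ₗ p) hq
      replace hf₁ : ∀ x, p (f₁ x) = f (q x) := LinearMap.congr_fun hf₁
      replace hg₁ : ∀ x, q (g₁ x) = g (p x) := LinearMap.congr_fun hg₁
      obtain ⟨f₂, hf₂⟩ := exists_lift_of_exact hi hip (f₁ ∘ₗ j) (fun x => by
        simp [hf₁, hjq.apply_apply_eq_zero])
      obtain ⟨g₂, hg₂⟩ := exists_lift_of_exact hj hjq (g₁ ∘ₗ i) (fun x => by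
        simp [hg₁, hip.apply_apply_eq_zero])
      refine ⟨g₁ ∘ₗ f₁, g₂ ∘ₗ f₂, hL.sumsThrough_le (comp_mem_sumsThrough _ _), ?_, ?_⟩
      · intro x
        simp [hf₁, hg₁]
      · intro x
        simp only [LinearMap.comp_apply] at hf₂ hg₂ ⊢
        rw [hg₂, hf₂]
    | zero => exact ⟨0, 0, zero_mem _, by simp, by simp⟩
    | add x y _ _ hx hy =>
      obtain ⟨b, c, hc, h1, h2⟩ := hx
      obtain ⟨b', c', hc', h1', h2'⟩ := hy
      exact ⟨b + b', c + c', add_mem hc hc', by simp [h1, h1'], by simp [h2, h2']⟩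
    | neg x _ hx =>
      obtain ⟨b, c, hc, h1, h2⟩ := hx
      exact ⟨-b, -c, neg_mem hc, by simp [h1], by simp [h2]⟩
  obtain ⟨b, c, hc, h1, h2⟩ := key _ h
  -- For a = id the difference id - b lands in K, so id - c on K factors through the projective Q.
  -- This is why R has to be added to L.
  obtain ⟨s, hs⟩ := exists_lift_of_exact hj hjq (LinearMap.id - b) (fun x => by simp [h1])
  have hsum : (LinearMap.id : K →ₗ[R] K) = c + s ∘ₗ j := by
    ext x
    apply hj
    rw [LinearMap.add_apply, map_add, LinearMap.comp_apply, hs, ← h2]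
    simp
  rw [MemAdd, hsum]
  exact add_mem hc (hQ.sumsThrough_le (comp_mem_sumsThrough _ _))

end MemAdd

end AddClosure

/-! ### Resolutions by an additive closure -/

section Resolution

variable {R : Type u} [Ring R]

/-- There is an exact sequence `0 ⟶ U m ⟶ ⋯ ⟶ U 0 ⟶ K ⟶ 0` whose terms `U i` lie in `add U`. -/
def HasRes (R : Type u) [Ring R] (U : Type u) [AddCommGroup U] [Module R U] :
    ℕ → (K : Type u) → [AddCommGroup K] → [Module R K] → Prop
  | 0, K, _, _ => MemAdd R U K
  | m + 1, K, _, _ => ∃ V K' : ModuleCat.{u} R, MemAdd R U V ∧ IsExt R K' V K ∧ HasRes R U m K'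

namespace HasRes

variable {A B C D K L P U W : Type u} [AddCommGroup U] [Module R U] [AddCommGroup W] [Module R W]
variable [AddCommGroup A] [Module R A] [AddCommGroup B] [Module R B] [AddCommGroup C] [Module R C]
variable [AddCommGroup D] [Module R D] [AddCommGroup P] [Module R P]
variable [AddCommGroup K] [Module R K] [AddCommGroup L] [Module R L] {m n : ℕ}

theorem congr (h : HasRes R U m K) (a : K ≃ₗ[R] L) : HasRes R U m L := by
  cases m with
  | zero => exact MemAdd.of_equiv h a
  | succ m =>
    obtain ⟨V, K', hV, hE, hK⟩ := h
    exact ⟨V, K', hV, hE.congr (.refl R _) (.refl R _) a, hK⟩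

theorem of_subsingleton (m : ℕ) (K : Type u) [AddCommGroup K] [Module R K] [Subsingleton K] :
    HasRes R U m K := by
  induction m generalizing K with
  | zero => exact MemAdd.of_subsingleton
  | succ m ih =>
    exact ⟨ModuleCat.of R K, ModuleCat.of R PUnit.{u + 1},
      MemAdd.of_subsingleton (M := K), isExt_self_punit K, ih PUnit.{u + 1}⟩

theorem of_memAdd (m : ℕ) (h : MemAdd R U K) : HasRes R U m K := by
  cases m with
  | zero => exact h
  | succ m =>
    exact ⟨ModuleCat.of R K, ModuleCat.of R PUnit.{u + 1}, h, isExt_self_punit K,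
      of_subsingleton m PUnit.{u + 1}⟩

theorem mono {K : Type u} [AddCommGroup K] [Module R K]
    (h : HasRes R U m K) (hU : MemAdd R W U) (hmn : m ≤ n) : HasRes R W n K := by
  induction m generalizing n K with
  | zero => exact of_memAdd n (hU.trans h)
  | succ m ih =>
    obtain ⟨V, K', hV, hE, hK⟩ := h
    obtain ⟨n, rfl⟩ := Nat.exists_eq_add_of_le' (le_trans (Nat.le_add_left 1 m) hmn)
    exact ⟨V, K', hU.trans hV, hE, ih hK (by omega)⟩

theorem prod_memAdd (h : HasRes R U m K) (hW : MemAdd R U W) : HasRes R U m (K × W) := by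
  cases m with
  | zero => exact MemAdd.prod h hW
  | succ m =>
    obtain ⟨V, K', hV, hE, hK⟩ := h
    exact ⟨ModuleCat.of R (V × W), K', hV.prod hW,
      (hE.prod (isExt_self_punit W)).congr LinearEquiv.prodUnique (.refl R _) (.refl R _), hK⟩

/-- The kernel of V ⟶ K × P ⟶ K is an extension of P by K', hence K' × P, and P lies in `add U`. So
projective summands produced by the horseshoe construction can be cancelled without changing the
length. -/
theorem fst_of_prod [Module.Projective R P] (h : HasRes R U m (K × P)) (hP : MemAdd R U P) :
    HasRes R U m K := by
  cases m with
  | zero => exact MemAdd.fst_of_prod h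
  | succ m =>
    obtain ⟨V, K', hV, hE, hK⟩ := h
    obtain ⟨E, h1, h2⟩ := hE.comp
      ((isExt_prod P K).congr (.refl R P) (LinearEquiv.prodComm R P K) (.refl R K))
    obtain ⟨a⟩ := h2.nonempty_equiv_prod
    exact ⟨V, E, hV, h1, (hK.prod_memAdd hP).congr a.symm⟩

/-- Resolutions of an extension of `C` by `A`, when `D` is a high syzygy of `C`. -/
theorem extension {A B C D : Type u} [AddCommGroup A] [Module R A] [AddCommGroup B] [Module R B]
    [AddCommGroup C] [Module R C] [AddCommGroup D] [Module R D] (hU : MemAdd R U R)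
    (h : IsExt R A B C) (hA : HasRes R U n A) (hC : SyzOf R (n + 1) D C) (hD : HasRes R U m D) :
    HasRes R U (m + n + 1) B := by
  induction n generalizing A B C with
  | zero =>
    -- Rotation yields 0 → C' → A × P → B → 0, with A × P already in `add U` and C' ≅ D.
    obtain ⟨P, C', _, _, hE, ⟨a⟩⟩ := hC
    exact ⟨ModuleCat.of R (A × P), C', MemAdd.prod hA (hU.trans .of_projective), h.rotate hE,
      hD.congr a⟩
  | succ n ih =>
    obtain ⟨P, C', _, _, hE, hS⟩ := hC
    obtain ⟨V, A', hV, hE', hA'⟩ := hA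
    -- The kernel E of V × P ⟶ A × P ⟶ B is an extension of C' by A': the resolution of A gets
    -- shorter while C moves to its syzygy.
    obtain ⟨E, h1, h2⟩ := ((hE'.prod (isExt_self_punit P)).congr LinearEquiv.prodUnique
      (.refl R _) (.refl R _)).comp (h.rotate hE)
    exact ⟨ModuleCat.of R (V × P), E, hV.prod (hU.trans .of_projective), h1, ih h2 hA' hS⟩

/-- Resolutions of the quotient by a projective submodule. -/
theorem quotient [Module.Finite R P] [Module.Projective R P] (hU : MemAdd R U R)
    (h : IsExt R P B C) (hB : HasRes R U n B) : HasRes R U (n + 1) C := by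
  cases n with
  | zero => exact ⟨ModuleCat.of R B, ModuleCat.of R P, hB, h, hU.trans .of_projective⟩
  | succ n =>
    obtain ⟨V, B', hV, hE, hB'⟩ := hB
    -- The kernel E of V ⟶ B ⟶ C is an extension of P by B', so it splits. The length is n + 1
    -- already and is raised only to match the base case.
    obtain ⟨E, h1, h2⟩ := hE.comp h
    obtain ⟨a⟩ := h2.nonempty_equiv_prod
    exact ⟨V, E, hV, h1, ((hB'.prod_memAdd (hU.trans .of_projective)).congr a.symm).mono
      (.refl U) (Nat.le_succ n)⟩

/-- Three rotations turn 0 → K' → V → K → 0 into a cover of L × P₁ by V' × (projective) whose kernel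
is a syzygy of K'. Here V' is a syzygy of V, so it lies in `add (W × R)`; induction handles K', and
P₁ is cancelled. -/
theorem syzygy [IsNoetherianRing R] [Module.Finite R U] {P Q K L : Type u} [AddCommGroup P]
    [Module R P] [AddCommGroup Q] [Module R Q] [AddCommGroup K] [Module R K] [AddCommGroup L]
    [Module R L] [Module.Finite R P] [Module.Projective R P]
    [Module.Finite R Q] [Module.Projective R Q] (hU : IsExt R W P U)
    (h : HasRes R U m K) (hK : IsExt R L Q K) : HasRes R (W × R) m L := by
  induction m generalizing Q K L with
  | zero => exact MemAdd.syzygy h hU hK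
  | succ m ih =>
    have hR : MemAdd R (W × R) R := (MemAdd.refl (W × R)).snd_of_prod
    obtain ⟨V, K', hV, hE, hK'⟩ := h
    have := hV.finite
    have := hK.finite_right
    have := hE.finite_left
    obtain ⟨P₁, V', _, _, _, hE₁⟩ := exists_isExt_projective (R := R) V
    obtain ⟨P₂, K'', _, _, _, hE₂⟩ := exists_isExt_projective (R := R) (K' × Q)
    obtain ⟨P₃, K₃, _, _, _, hE₃⟩ := exists_isExt_projective (R := R) K'
    have h1 := (hE.rotate hK).rotate hE₁
    have h2 := h1.rotate (hE₃.prod (isExt_self_punit Q))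
    have h3 : HasRes R (W × R) (m + 1) (L × P₁) :=
      ⟨ModuleCat.of R (V' × (P₃ × Q)), ModuleCat.of R (K₃ × PUnit.{u + 1}),
        (hV.syzygy hU hE₁).prod (hR.trans .of_projective), h2,
        (ih hK' hE₃).congr LinearEquiv.prodUnique.symm⟩
    exact h3.fst_of_prod (hR.trans .of_projective)

/-- Syzygies of modules with a resolution by `add U` have resolutions of the same length by a
suitable `add W`. -/
theorem exists_syzygy [IsNoetherianRing R] (j : ℕ) (U : Type u) [AddCommGroup U]
    [Module R U] [Module.Finite R U] : ∃ W : ModuleCat.{u} R, Module.Finite R W ∧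
      ∀ (m : ℕ) (K L : ModuleCat.{u} R), HasRes R U m K → SyzOf R j L K → HasRes R W m L := by
  induction j generalizing U with
  | zero =>
    exact ⟨ModuleCat.of R U, inferInstanceAs (Module.Finite R U), fun m K L h ⟨a⟩ => h.congr a.symm⟩
  | succ j ih =>
    obtain ⟨P, V, _, _, _, hE⟩ := exists_isExt_projective (R := R) U
    obtain ⟨W, hW, h⟩ := ih (V × R)
    refine ⟨W, hW, ?_⟩
    rintro m K L hK ⟨Q, K', _, _, hE', hS⟩
    exact h m K' L (hK.syzygy hE hE') hS

end HasRes

end Resolution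

/-! ### Comparison of long exact sequences with the recursive notions -/

section ExactSequences

variable {R : Type u} [Ring R]

namespace FGExactSeq

/-- The isomorphism given by an exact sequence of length zero. -/
noncomputable def equivOfZero {X : ModuleCat.{u} R} (S : FGExactSeq R 0 X) : S.V 0 ≃ₗ[R] X :=
  LinearEquiv.ofBijective S.ε ⟨by
    have := S.zero 1 Nat.one_pos
    rw [injective_iff_map_eq_zero]
    intro x hx
    obtain ⟨y, rfl⟩ := (S.exact_zero x).1 hx
    rw [Subsingleton.elim y 0, map_zero], S.surjective⟩

/-- The exact sequence of length zero given by an isomorphism. -/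
def ofEquiv {K X : ModuleCat.{u} R} (a : K ≃ₗ[R] X) (hK : Module.Finite R K) :
    FGExactSeq R 0 X where
  V
    | 0 => K
    | _ + 1 => ModuleCat.of R PUnit.{u + 1}
  d _ := 0
  ε := a.toLinearMap
  finite
    | 0 => hK
    | _ + 1 => inferInstanceAs (Module.Finite R PUnit.{u + 1})
  zero
    | _ + 1, _ => inferInstanceAs (Subsingleton PUnit.{u + 1})
  exact_succ _ y := ⟨fun _ => ⟨0, Subsingleton.elim (α := PUnit.{u + 1}) _ _⟩, fun _ => rfl⟩
  exact_zero y := ⟨fun h => ⟨0, (a.map_eq_zero_iff.1 h).symm⟩, by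
    rintro ⟨x, rfl⟩
    exact a.map_zero⟩
  surjective := a.surjective

/-- Removing the term next to the augmented module. -/
def tail {n : ℕ} {X : ModuleCat.{u} R} (S : FGExactSeq R (n + 1) X) :
    FGExactSeq R n (ModuleCat.of R (LinearMap.ker S.ε)) where
  V i := S.V (i + 1)
  d i := S.d (i + 1)
  ε := (S.d 0).codRestrict _ fun x => S.exact_zero.apply_apply_eq_zero x
  finite i := S.finite (i + 1)
  zero i hi := S.zero (i + 1) (by omega)
  exact_succ i := S.exact_succ (i + 1)
  exact_zero y := by
    rw [← S.exact_succ 0 y]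
    exact Subtype.ext_iff
  surjective := by
    rintro ⟨y, hy⟩
    obtain ⟨x, rfl⟩ := (S.exact_zero y).1 hy
    exact ⟨x, rfl⟩

/-- Splicing an exact sequence with a short exact sequence. -/
def cons {n : ℕ} {X X' P : ModuleCat.{u} R} (S : FGExactSeq R n X') (hP : Module.Finite R P)
    (f : X' →ₗ[R] P) (g : P →ₗ[R] X) (hf : Function.Injective f) (hfg : Function.Exact f g)
    (hg : Function.Surjective g) : FGExactSeq R (n + 1) X where
  V
    | 0 => P
    | i + 1 => S.V i
  d
    | 0 => f ∘ₗ S.ε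
    | i + 1 => S.d i
  ε := g
  finite
    | 0 => hP
    | i + 1 => S.finite i
  zero
    | i + 1, hi => S.zero i (by omega)
  exact_succ
    | 0 => by
      intro y
      rw [← S.exact_zero y, LinearMap.comp_apply, ← hf.eq_iff, map_zero]
    | i + 1 => S.exact_succ i
  exact_zero := by
    intro y
    rw [hfg]
    constructor
    · rintro ⟨x, rfl⟩
      obtain ⟨z, rfl⟩ := S.surjective x
      exact ⟨z, rfl⟩
    · rintro ⟨z, rfl⟩
      exact ⟨S.ε z, rfl⟩
  surjective := hg

theorem isExt {n : ℕ} {X : ModuleCat.{u} R} (S : FGExactSeq R n X) :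
    IsExt R (ModuleCat.of R (LinearMap.ker S.ε)) (S.V 0) X :=
  isExt_ker S.ε S.surjective

end FGExactSeq

theorem isSyzygyOf_iff [IsNoetherianRing R] {n : ℕ} {K X : ModuleCat.{u} R}
    (hX : Module.Finite R X) : IsSyzygyOf n K X ↔ SyzOf R n K X := by
  induction n generalizing X with
  | zero =>
    constructor
    · rintro ⟨S, -, ⟨a⟩⟩
      exact ⟨a.trans S.equivOfZero⟩
    · rintro ⟨a⟩
      exact ⟨FGExactSeq.ofEquiv a (Module.Finite.equiv a.symm), fun i hi => absurd hi (by omega),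
        ⟨.refl R K⟩⟩
  | succ n ih =>
    constructor
    · rintro ⟨S, hS, ⟨a⟩⟩
      have := S.finite 0
      exact ⟨S.V 0, ModuleCat.of R (LinearMap.ker S.ε), S.finite 0, hS 0 (by omega), S.isExt,
        (ih S.isExt.finite_left).1 ⟨S.tail, fun i hi => hS (i + 1) (by omega), ⟨a⟩⟩⟩
    · rintro ⟨P, X', hP, hP', hE, hS⟩
      obtain ⟨S, hS, ⟨a⟩⟩ := (ih hE.finite_left).2 hS
      obtain ⟨f, g, hf, hfg, hg⟩ := hE
      refine ⟨S.cons hP f g hf hfg hg, fun i hi => ?_, ⟨a⟩⟩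
      cases i with
      | zero => exact hP'
      | succ i => exact hS i (by omega)

theorem exists_fgExactSeq_iff {m : ℕ} {U K : ModuleCat.{u} R} (hU : Module.Finite R U) :
    (∃ S : FGExactSeq R m K, ∀ i, i ≤ m → InAdd U (S.V i)) ↔ HasRes R U m K := by
  induction m generalizing K with
  | zero =>
    constructor
    · rintro ⟨S, hS⟩
      exact (MemAdd.iff_inAdd.2 (hS 0 le_rfl)).of_equiv S.equivOfZero
    · intro h
      refine ⟨FGExactSeq.ofEquiv (.refl R K) (MemAdd.finite h), fun i hi => ?_⟩
      obtain rfl : i = 0 := by omega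
      exact MemAdd.iff_inAdd.1 h
  | succ m ih =>
    constructor
    · rintro ⟨S, hS⟩
      exact ⟨S.V 0, ModuleCat.of R (LinearMap.ker S.ε), MemAdd.iff_inAdd.2 (hS 0 (by omega)),
        S.isExt, ih.1 ⟨S.tail, fun i hi => hS (i + 1) (by omega)⟩⟩
    · rintro ⟨V, K', hV, ⟨f, g, hf, hfg, hg⟩, hK⟩
      obtain ⟨S, hS⟩ := ih.2 hK
      refine ⟨S.cons hV.finite f g hf hfg hg, fun i hi => ?_⟩
      cases i with
      | zero => exact MemAdd.iff_inAdd.1 hV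
      | succ i => exact hS i (by omega)

theorem isITCat_iff [IsNoetherianRing R] {m n : ℕ} : IsITCat R m n ↔
    ∃ U : ModuleCat.{u} R, Module.Finite R U ∧ ∀ K X : ModuleCat.{u} R, Module.Finite R X →
      SyzOf R n K X → HasRes R U m K := by
  refine exists_congr fun U => and_congr_right fun hU => ⟨fun h K X hX hK => ?_, fun h K hK => ?_⟩
  · exact (exists_fgExactSeq_iff hU).1 (h K ⟨hK.finite, X, hX, (isSyzygyOf_iff hX).2 hK⟩)
  · obtain ⟨-, X, hX, hS⟩ := hK
    exact (exists_fgExactSeq_iff hU).2 (h K X hX ((isSyzygyOf_iff hX).1 hS))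

theorem IsITCat.mono [IsNoetherianRing R] {m n m' n' : ℕ} (h : IsITCat R m n) (hm : m ≤ m')
    (hn : n ≤ n') : IsITCat R m' n' := by
  rw [isITCat_iff] at h ⊢
  obtain ⟨U, hU, h⟩ := h
  refine ⟨U, hU, fun K X hX hK => ?_⟩
  obtain ⟨j, rfl⟩ := Nat.exists_eq_add_of_le' hn
  obtain ⟨L, h1, h2⟩ := hK.exists_of_add
  exact (h K L h1.finite h2).mono (.refl U) hm

/-- One further syzygy can be traded for one more step in the resolutions. -/
theorem isITCat_of_succ [IsNoetherianRing R] {m n : ℕ} (h : IsITCat R m (n + 1)) :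
    IsITCat R (m + 1) n := by
  rw [isITCat_iff] at h ⊢
  obtain ⟨U, hU, h⟩ := h
  refine ⟨ModuleCat.of R (U × R), inferInstanceAs (Module.Finite R (U × R)), fun K X hX hK => ?_⟩
  have := hK.finite
  obtain ⟨P, K', hP, hP', -, hE⟩ := exists_isExt_projective (R := R) K
  have hUR : MemAdd R (U × R) (U × R) := .refl _
  exact ⟨P, K', hUR.snd_of_prod.trans .of_projective, hE,
    (h K' X hX (hK.trans ⟨P, K', hP, hP', hE, ⟨.refl R _⟩⟩)).mono hUR.fst_of_prod le_rfl⟩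

end ExactSequences

/-! ### Exact additive functors and restriction of scalars -/

section ExactFunctors

/-- An exact additive functor between module categories, on the level of linear maps. -/
structure ExactAddFunctor (R S : Type u) [Ring R] [Ring S] where
  /-- the action on modules -/
  obj : ModuleCat.{u} R → ModuleCat.{u} S
  /-- the action on linear maps -/
  map : ∀ {M N : ModuleCat.{u} R}, (M →ₗ[R] N) →+ (obj M →ₗ[S] obj N)
  map_id : ∀ M : ModuleCat.{u} R, map (LinearMap.id : M →ₗ[R] M) = LinearMap.id
  map_comp : ∀ {L M N : ModuleCat.{u} R} (f : L →ₗ[R] M) (g : M →ₗ[R] N),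
    map (g ∘ₗ f) = map g ∘ₗ map f
  map_injective : ∀ {M N : ModuleCat.{u} R} (f : M →ₗ[R] N), Function.Injective f →
    Function.Injective (map f)
  map_exact : ∀ {L M N : ModuleCat.{u} R} (f : L →ₗ[R] M) (g : M →ₗ[R] N), Function.Exact f g →
    Function.Exact (map f) (map g)
  map_surjective : ∀ {M N : ModuleCat.{u} R} (f : M →ₗ[R] N), Function.Surjective f →
    Function.Surjective (map f)

theorem finite_iff_of_smul_eq {R T M : Type u} [Ring R] [Ring T] [AddCommGroup M]
    [hR : Module R M] [Module T M] {π : R →+* T} (hπ : Function.Surjective π)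
    (h : ∀ (r : R) (x : M), r • x = π r • x) : Module.Finite R M ↔ Module.Finite T M := by
  have key : ∀ s : Set M, ∀ x, x ∈ Submodule.span R s ↔ x ∈ Submodule.span T s := by
    intro s x
    constructor
    · intro hx
      induction hx using Submodule.span_induction with
      | mem y hy => exact Submodule.subset_span hy
      | zero => exact zero_mem _
      | add y z _ _ hy hz => exact add_mem hy hz
      | smul r y _ hy =>
        rw [h]
        exact Submodule.smul_mem _ _ hy
    · intro hx
      induction hx using Submodule.span_induction with
      | mem y hy => exact Submodule.subset_span hy
      | zero => exact zero_mem _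
      | add y z _ _ hy hz => exact add_mem hy hz
      | smul r y _ hy =>
        obtain ⟨r, rfl⟩ := hπ r
        rw [← h]
        exact Submodule.smul_mem _ _ hy
  constructor
  · rintro ⟨s, hs⟩
    exact ⟨s, eq_top_iff.2 fun x _ => (key _ x).1 (hs ▸ Submodule.mem_top)⟩
  · rintro ⟨s, hs⟩
    exact ⟨s, eq_top_iff.2 fun x _ => (key _ x).2 (hs ▸ Submodule.mem_top)⟩

namespace ExactAddFunctor

variable {R S : Type u} [Ring R] [Ring S] (F : ExactAddFunctor R S)

theorem isExt {A B C : ModuleCat.{u} R} (h : IsExt R A B C) :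
    IsExt S (F.obj A) (F.obj B) (F.obj C) := by
  obtain ⟨f, g, hf, hfg, hg⟩ := h
  exact ⟨F.map f, F.map g, F.map_injective f hf, F.map_exact f g hfg, F.map_surjective g hg⟩

theorem memAdd {U M : ModuleCat.{u} R} (h : MemAdd R U M) : MemAdd S (F.obj U) (F.obj M) := by
  have key : ∀ a ∈ sumsThrough R U M M, F.map a ∈ sumsThrough S (F.obj U) (F.obj M) (F.obj M) := by
    intro a ha
    induction ha using AddSubgroup.closure_induction with
    | mem x hx =>
      obtain ⟨f, g, rfl⟩ := hx
      rw [F.map_comp]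
      exact comp_mem_sumsThrough _ _
    | zero =>
      rw [map_zero]
      exact zero_mem _
    | add x y _ _ hx hy =>
      rw [map_add]
      exact add_mem hx hy
    | neg x _ hx =>
      rw [map_neg]
      exact neg_mem hx
  have := key _ h
  rwa [F.map_id] at this

/-- The action on isomorphisms. -/
def mapEquiv {M N : ModuleCat.{u} R} (a : M ≃ₗ[R] N) : F.obj M ≃ₗ[S] F.obj N :=
  LinearEquiv.ofLinearMap (F.map a.toLinearMap) (F.map a.symm.toLinearMap)
    (by rw [← F.map_comp, ← F.map_id]; congr 1; ext; simp)
    (by rw [← F.map_comp, ← F.map_id]; congr 1; ext; simp)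

theorem hasRes {m : ℕ} {U K : ModuleCat.{u} R} (h : HasRes R U m K) :
    HasRes S (F.obj U) m (F.obj K) := by
  induction m generalizing K with
  | zero => exact F.memAdd h
  | succ m ih =>
    obtain ⟨V, K', hV, hE, hK⟩ := h
    exact ⟨F.obj V, F.obj K', F.memAdd hV, F.isExt hE, ih hK⟩

/-- The hypothesis `hF` makes F preserve finitely generated projectives, since these form `add R`.
-/
theorem syzOf (hF : MemAdd S S (F.obj (ModuleCat.of R R))) {n : ℕ} {K X : ModuleCat.{u} R}
    (h : SyzOf R n K X) : SyzOf S n (F.obj K) (F.obj X) := by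
  induction n generalizing X with
  | zero =>
    obtain ⟨a⟩ := h
    exact ⟨F.mapEquiv a⟩
  | succ n ih =>
    obtain ⟨P, X', hP, hP', hE, hS⟩ := h
    have : MemAdd S S (F.obj P) :=
      hF.trans (F.memAdd (U := ModuleCat.of R R) (M := P) MemAdd.of_projective)
    exact ⟨F.obj P, F.obj X', this.finite, this.projective, F.isExt hE, ih hS⟩

theorem finite (hF : MemAdd S S (F.obj (ModuleCat.of R R))) {X : ModuleCat.{u} R}
    (hX : Module.Finite R X) : Module.Finite S (F.obj X) := by
  obtain ⟨n, f, hf⟩ := Module.Finite.exists_fin' R X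
  have : MemAdd S S (F.obj (ModuleCat.of R (Fin n → R))) :=
    hF.trans (F.memAdd (U := ModuleCat.of R R) (M := ModuleCat.of R (Fin n → R))
      (MemAdd.of_projective (M := Fin n → R)))
  have := this.finite
  exact Module.Finite.of_surjective _ (F.map_surjective (M := ModuleCat.of R (Fin n → R)) f hf)

/-- Restriction of scalars along a ring homomorphism. -/
noncomputable def restrict {T : Type u} [Ring T] (π : R →+* T) : ExactAddFunctor T R where
  obj M := (ModuleCat.restrictScalars π).obj M
  map :=
    { toFun := fun f =>
        { toFun := f
          map_add' := f.map_add
          map_smul' := fun r x => f.map_smul (π r) x }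
      map_zero' := rfl
      map_add' := fun _ _ => rfl }
  map_id _ := rfl
  map_comp _ _ := rfl
  map_injective _ h := h
  map_exact _ _ h := h
  map_surjective _ h := h

theorem finite_restrict {T : Type u} [Ring T] {π : R →+* T} (hπ : Function.Surjective π)
    {M : ModuleCat.{u} T} : Module.Finite R ((restrict π).obj M) ↔ Module.Finite T M :=
  finite_iff_of_smul_eq (M := M) (hR := ((restrict π).obj M).isModule) hπ fun _ _ => rfl

end ExactAddFunctor

end ExactFunctors

/-! ### Corner rings: the functors M ↦ εM and Y ↦ Rε ⊗ Y, unit and counit -/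

section Corner

/-- A corner `S = ε R ε` of a ring `R`, where `ε = ι 1`, together with a finite dual basis of the
right `S`-module `R ε`. -/
structure CornerData (R S : Type u) [Ring R] [Ring S] where
  /-- the inclusion of the corner -/
  ι : S →ₙ+* R
  ι_injective : Function.Injective ι
  exists_ι : ∀ x, ∃ s, ι s = ι 1 * x * ι 1
  /-- the size of the dual basis -/
  size : ℕ
  /-- the elements of the dual basis -/
  basis : Fin size → R
  /-- the coordinates with respect to the dual basis -/
  coord : Fin size → R →+ S
  coord_mul : ∀ i x s, coord i (x * ι s) = coord i x * s
  sum_coord : ∀ x, ∑ i, basis i * ι (coord i x) = x * ι 1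

namespace CornerData

variable {R S : Type u} [Ring R] [Ring S] (D : CornerData R S)

/-- The idempotent defining the corner. -/
def idem : R := D.ι 1

theorem ι_mul_idem (s : S) : D.ι s * D.idem = D.ι s := by
  rw [idem, ← map_mul, mul_one]

theorem idem_mul_ι (s : S) : D.idem * D.ι s = D.ι s := by
  rw [idem, ← map_mul, one_mul]

theorem idem_mul_idem : D.idem * D.idem = D.idem := D.ι_mul_idem 1

theorem coord_mul_idem (i x) : D.coord i (x * D.idem) = D.coord i x := by
  rw [idem, D.coord_mul, mul_one]

/-- Expand xε in the dual basis. Consequently a ↦ (coord j (a * basis i)) is a multiplicative map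
from R to matrices over S, which describes left multiplication on Rε. -/
theorem coord_mul_eq_sum (i) (a x : R) :
    D.coord i (a * x) = ∑ j, D.coord i (a * D.basis j) * D.coord j x := by
  rw [← D.coord_mul_idem, mul_assoc, idem, ← D.sum_coord, Finset.mul_sum, map_sum]
  exact Finset.sum_congr rfl fun j _ => by rw [← mul_assoc, D.coord_mul]

/-- The underlying additive group of the module `ε M` over the corner. -/
def Fixed (M : Type u) [AddCommGroup M] [Module R M] : AddSubgroup M where
  carrier := {x | D.idem • x = x}
  zero_mem' := smul_zero _
  add_mem' {x y} hx hy := (smul_add _ x y).trans (congrArg₂ _ hx hy)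
  neg_mem' {x} hx := (smul_neg _ x).trans (congrArg _ hx)

instance (M : Type u) [AddCommGroup M] [Module R M] : Module S (D.Fixed M) where
  smul s x := ⟨D.ι s • x.1, by
    change D.idem • D.ι s • x.1 = D.ι s • x.1
    rw [smul_smul, D.idem_mul_ι]⟩
  one_smul x := Subtype.ext x.2
  mul_smul a b x := Subtype.ext <| by
    change D.ι (a * b) • x.1 = D.ι a • D.ι b • x.1
    rw [map_mul, mul_smul]
  smul_zero a := Subtype.ext (smul_zero (D.ι a))
  smul_add a x y := Subtype.ext (smul_add (D.ι a) x.1 y.1)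
  add_smul a b x := Subtype.ext <| by
    change D.ι (a + b) • x.1 = D.ι a • x.1 + D.ι b • x.1
    rw [map_add, add_smul]
  zero_smul x := Subtype.ext <| by
    change D.ι 0 • x.1 = 0
    rw [map_zero, zero_smul]

theorem coe_smul {M : Type u} [AddCommGroup M] [Module R M] (s : S) (x : D.Fixed M) :
    ((s • x : D.Fixed M) : M) = D.ι s • (x : M) := rfl

theorem idem_smul_coe {M : Type u} [AddCommGroup M] [Module R M] (x : D.Fixed M) :
    D.idem • (x : M) = x := x.2

theorem idem_smul_mem {M : Type u} [AddCommGroup M] [Module R M] (x : M) :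
    D.idem • x ∈ D.Fixed M := by
  change D.idem • D.idem • x = D.idem • x
  rw [smul_smul, D.idem_mul_idem]

/-- The exact functor `M ↦ ε M` to the modules over the corner. -/
def fixed : ExactAddFunctor R S where
  obj M := ModuleCat.of S (D.Fixed M)
  map {M N} :=
    { toFun := fun f =>
        { toFun := fun x => ⟨f x.1, (f.map_smul _ _).symm.trans (congrArg f x.2)⟩
          map_add' := fun x y => Subtype.ext (f.map_add x.1 y.1)
          map_smul' := fun s x => Subtype.ext (f.map_smul (D.ι s) x.1) }
      map_zero' := rfl
      map_add' := fun _ _ => rfl }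
  map_id _ := rfl
  map_comp _ _ := rfl
  map_injective f hf x y hxy := Subtype.ext (hf (congrArg Subtype.val hxy))
  map_exact f g h y := by
    constructor
    · intro hy
      obtain ⟨x, hx⟩ := (h y.1).1 (congrArg Subtype.val hy)
      refine ⟨⟨D.idem • x, D.idem_smul_mem x⟩, Subtype.ext ?_⟩
      change f (D.idem • x) = y.1
      rw [map_smul, hx]
      exact y.2
    · rintro ⟨x, rfl⟩
      exact Subtype.ext (h.apply_apply_eq_zero x.1)
  map_surjective f hf y := by
    obtain ⟨x, hx⟩ := hf y.1
    refine ⟨⟨D.idem • x, D.idem_smul_mem x⟩, Subtype.ext ?_⟩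
    change f (D.idem • x) = y.1
    rw [map_smul, hx]
    exact y.2

/-- The underlying additive group of the module `R ε ⊗ Y` induced from the corner, realized by the
coordinate vectors with respect to the dual basis. -/
def Induced (Y : Type u) [AddCommGroup Y] [Module S Y] : AddSubgroup (Fin D.size → Y) where
  -- The matrix of 1 is idempotent but need not be the identity, as the dual basis need not be a
  -- basis; Rε ⊗ Y is its image on coordinate vectors, that is, its fixed vectors.
  carrier := {v | ∀ j, ∑ i, D.coord j (D.basis i) • v i = v j}
  zero_mem' j := by simp
  add_mem' {v w} hv hw j := by simp [smul_add, Finset.sum_add_distrib, hv j, hw j]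
  neg_mem' {v} hv j := by simp [hv j]

section Induced

variable {Y Z : Type u} [AddCommGroup Y] [Module S Y] [AddCommGroup Z] [Module S Z]

/-- The action of `R` on coordinate vectors. -/
def act (a : R) (v : Fin D.size → Y) : Fin D.size → Y :=
  fun j => ∑ i, D.coord j (a * D.basis i) • v i

theorem act_act (a b : R) (v : Fin D.size → Y) : D.act a (D.act b v) = D.act (a * b) v := by
  funext j
  simp only [act, Finset.smul_sum, smul_smul]
  rw [Finset.sum_comm]
  refine Finset.sum_congr rfl fun i _ => ?_
  rw [← Finset.sum_smul, ← D.coord_mul_eq_sum, mul_assoc]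

theorem act_one (v : D.Induced Y) : D.act 1 v.1 = v.1 := by
  funext j
  simpa [act] using v.2 j

theorem act_mem (a : R) (v : Fin D.size → Y) : D.act a v ∈ D.Induced Y := by
  intro j
  have := congrFun (D.act_act 1 a v) j
  simpa [act] using this

instance : Module R (D.Induced Y) where
  smul a v := ⟨D.act a v.1, D.act_mem a v.1⟩
  one_smul v := Subtype.ext (D.act_one v)
  mul_smul a b v := Subtype.ext (D.act_act a b v.1).symm
  smul_zero a := Subtype.ext <| funext fun j => by
    change ∑ i, D.coord j (a * D.basis i) • (0 : Y) = 0
    simp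
  smul_add a v w := Subtype.ext <| funext fun j => by
    change ∑ i, D.coord j (a * D.basis i) • (v.1 i + w.1 i) =
      ∑ i, D.coord j (a * D.basis i) • v.1 i + ∑ i, D.coord j (a * D.basis i) • w.1 i
    simp [smul_add, Finset.sum_add_distrib]
  add_smul a b v := Subtype.ext <| funext fun j => by
    change ∑ i, D.coord j ((a + b) * D.basis i) • v.1 i =
      ∑ i, D.coord j (a * D.basis i) • v.1 i + ∑ i, D.coord j (b * D.basis i) • v.1 i
    simp [add_mul, add_smul, Finset.sum_add_distrib]
  zero_smul v := Subtype.ext <| funext fun j => by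
    change ∑ i, D.coord j (0 * D.basis i) • v.1 i = 0
    simp

theorem coe_smul_induced (a : R) (v : D.Induced Y) (j : Fin D.size) :
    (a • v).1 j = ∑ i, D.coord j (a * D.basis i) • v.1 i := rfl

theorem map_act (f : Y →ₗ[S] Z) (a : R) (v : Fin D.size → Y) (j : Fin D.size) :
    f (D.act a v j) = D.act a (fun i => f (v i)) j := by
  simp [act]

end Induced

/-- The exact induction functor `Y ↦ R ε ⊗ Y`. -/
def induced : ExactAddFunctor S R where
  obj Y := ModuleCat.of R (D.Induced Y)
  map {Y Z} :=
    { toFun := fun f =>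
        { toFun := fun v => ⟨fun i => f (v.1 i), fun j => by
            change ∑ i, D.coord j (D.basis i) • f (v.1 i) = f (v.1 j)
            rw [← v.2 j, map_sum]
            simp⟩
          map_add' := fun v w => Subtype.ext <| funext fun i => f.map_add (v.1 i) (w.1 i)
          map_smul' := fun a v => Subtype.ext <| funext fun i => D.map_act f a v.1 i }
      map_zero' := rfl
      map_add' := fun _ _ => rfl }
  map_id _ := rfl
  map_comp _ _ := rfl
  map_injective f hf v w hvw :=
    Subtype.ext <| funext fun i => hf (congrFun (congrArg Subtype.val hvw) i)
  map_exact f g h v := by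
    constructor
    · intro hv
      -- Preimages chosen coordinatewise need not satisfy the fixed-vector condition. Applying the
      -- idempotent `act 1` repairs this and commutes with the map, so v is still hit.
      choose w hw using fun i => (h (v.1 i)).1 (congrFun (congrArg Subtype.val hv) i)
      refine ⟨⟨D.act 1 w, D.act_mem 1 w⟩, Subtype.ext <| funext fun i => ?_⟩
      refine (D.map_act f 1 w i).trans ?_
      rw [funext hw, D.act_one]
    · rintro ⟨w, rfl⟩
      exact Subtype.ext <| funext fun i => h.apply_apply_eq_zero (w.1 i)
  map_surjective f hf v := by
    choose w hw using fun i => hf (v.1 i)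
    refine ⟨⟨D.act 1 w, D.act_mem 1 w⟩, Subtype.ext <| funext fun i => ?_⟩
    refine (D.map_act f 1 w i).trans ?_
    rw [funext hw, D.act_one]

/-- Rε ⊗ S ≅ Rε is a direct summand of R: a coordinate vector goes to its expansion, and an element
of R to its coordinates. -/
theorem induced_self : MemAdd R R (D.induced.obj (ModuleCat.of S S)) := by
  refine (MemAdd.refl (R := R) R).of_retract (M := D.Induced S)
    { toFun := fun v => ∑ i, D.basis i * D.ι (v.1 i)
      map_add' := fun v w => ?_
      map_smul' := fun a v => ?_ }
    { toFun := fun x => ⟨fun j => D.coord j x, fun j => ?_⟩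
      map_add' := fun x y => Subtype.ext <| funext fun j => map_add _ x y
      map_smul' := fun a x => Subtype.ext <| funext fun j => D.coord_mul_eq_sum j a x }
    (LinearMap.ext fun v => Subtype.ext <| funext fun j => ?_)
  · change ∑ i, D.basis i * D.ι (v.1 i + w.1 i) = _
    simp [mul_add, Finset.sum_add_distrib]
  · simp only [coe_smul_induced, RingHom.id_apply, smul_eq_mul, map_sum, Finset.mul_sum, map_mul]
    rw [Finset.sum_comm]
    refine Finset.sum_congr rfl fun i _ => ?_
    simp only [← mul_assoc]
    rw [← Finset.sum_mul, D.sum_coord, mul_assoc, mul_assoc, mul_assoc]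
    congr 2
    exact D.idem_mul_ι _
  · simpa using (D.coord_mul_eq_sum j 1 x).symm
  · change D.coord j (∑ i, D.basis i * D.ι (v.1 i)) = v.1 j
    rw [map_sum, ← v.2 j]
    simp [D.coord_mul]

section Unit

variable (Y : Type u) [AddCommGroup Y] [Module S Y]

/-- The unit `Y ⟶ ε (R ε ⊗ Y)`. -/
def unit : Y →ₗ[S] D.Fixed (D.Induced Y) where
  toFun y := ⟨⟨fun j => D.coord j D.idem • y, fun j => by
      change ∑ i, D.coord j (D.basis i) • D.coord i D.idem • y = D.coord j D.idem • y
      have := D.coord_mul_eq_sum j 1 D.idem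
      simp only [one_mul] at this
      rw [this, Finset.sum_smul]
      simp [mul_smul]⟩, Subtype.ext <| funext fun j => by
      rw [coe_smul_induced]
      simp only [smul_smul]
      rw [← Finset.sum_smul, ← D.coord_mul_eq_sum, D.idem_mul_idem]⟩
  map_add' x y := Subtype.ext <| Subtype.ext <| funext fun j => smul_add _ x y
  map_smul' s y := Subtype.ext <| Subtype.ext <| funext fun j => by
    simp only [RingHom.id_apply, coe_smul, coe_smul_induced, smul_smul]
    rw [← Finset.sum_smul, ← D.coord_mul_eq_sum, D.ι_mul_idem, ← D.coord_mul, D.idem_mul_ι]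

variable {Y}

theorem coe_unit (y : Y) (j : Fin D.size) : (D.unit Y y).1.1 j = D.coord j D.idem • y := rfl

theorem sum_basis_smul_unit (v : D.Induced Y) :
    ∑ i, D.basis i • (D.unit Y (v.1 i)).1 = v := by
  refine Subtype.ext <| funext fun j => ?_
  rw [AddSubgroup.val_finsetSum, Finset.sum_apply, ← v.2 j]
  refine Finset.sum_congr rfl fun i _ => ?_
  simp only [coe_smul_induced, coe_unit, smul_smul]
  rw [← Finset.sum_smul, ← D.coord_mul_eq_sum, D.coord_mul_idem]

/-- Every element of ε(Rε ⊗ Y) comes from Y, with explicit preimage ∑ (ε bᵢ ε) vᵢ. For Y = εX this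
preimage equals ε times the counit of v, which is how the kernel of the counit is seen to be killed
by ε. -/
theorem exists_unit_eq_idem_smul (v : D.Induced Y) : ∃ s : Fin D.size → S,
    (∀ i, D.ι (s i) = D.idem * D.basis i * D.idem) ∧
      (D.unit Y (∑ i, s i • v.1 i)).1 = D.idem • v := by
  choose s hs using fun i => D.exists_ι (D.basis i)
  refine ⟨s, hs, Subtype.ext <| funext fun j => ?_⟩
  rw [coe_unit, coe_smul_induced, Finset.smul_sum]
  refine Finset.sum_congr rfl fun i _ => ?_
  rw [smul_smul, ← D.coord_mul, hs, ← D.coord_mul_idem j (D.idem * D.basis i)]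
  congr 2
  rw [← idem, ← mul_assoc, ← mul_assoc, D.idem_mul_idem]

theorem unit_bijective : Function.Bijective (D.unit Y) := by
  constructor
  · rw [injective_iff_map_eq_zero]
    intro y hy
    choose s hs using fun i => D.exists_ι (D.basis i)
    -- This is the expansion of ε in the dual basis, multiplied by ε on the left; it recovers y from
    -- its coordinates.
    have h1 : ∑ i, s i * D.coord i D.idem = 1 := by
      apply D.ι_injective
      rw [map_sum]
      simp only [map_mul, hs, mul_assoc]
      have : ∀ i, D.ι 1 * (D.basis i * (D.ι 1 * D.ι (D.coord i D.idem))) =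
          D.idem * (D.basis i * D.ι (D.coord i D.idem)) := fun i => by
        rw [← idem, D.idem_mul_ι]
      simp only [this]
      rw [← Finset.mul_sum, D.sum_coord, ← idem, D.idem_mul_idem, D.idem_mul_idem]
    rw [← one_smul S y, ← h1, Finset.sum_smul]
    refine Finset.sum_eq_zero fun i _ => ?_
    rw [mul_smul, ← coe_unit, hy]
    exact smul_zero _
  · intro v
    obtain ⟨s, -, hs⟩ := D.exists_unit_eq_idem_smul v.1
    exact ⟨_, Subtype.ext (hs.trans (D.idem_smul_coe v))⟩

end Unit

section Counit

variable (X : Type u) [AddCommGroup X] [Module R X]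

/-- The counit `R ε ⊗ ε X ⟶ X`. -/
def counit : D.Induced (D.Fixed X) →ₗ[R] X where
  toFun v := ∑ i, D.basis i • (v.1 i : X)
  map_add' v w := by
    change ∑ i, D.basis i • ((v.1 i : X) + (w.1 i : X)) = _
    simp [smul_add, Finset.sum_add_distrib]
  map_smul' a v := by
    simp only [coe_smul_induced, AddSubgroup.val_finsetSum, coe_smul, Finset.smul_sum, smul_smul,
      RingHom.id_apply]
    rw [Finset.sum_comm]
    refine Finset.sum_congr rfl fun i _ => ?_
    rw [← Finset.sum_smul, D.sum_coord, ← idem, mul_smul, D.idem_smul_coe]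

variable {X}

theorem counit_apply (v : D.Induced (D.Fixed X)) :
    D.counit X v = ∑ i, D.basis i • (v.1 i : X) := rfl

theorem counit_unit (x : D.Fixed X) : D.counit X (D.unit (D.Fixed X) x).1 = x := by
  rw [counit_apply]
  simp only [coe_unit, coe_smul, smul_smul]
  rw [← Finset.sum_smul, D.sum_coord, ← idem, D.idem_mul_idem, D.idem_smul_coe]

theorem idem_smul_eq_zero_of_counit_eq_zero {v : D.Induced (D.Fixed X)} (h : D.counit X v = 0) :
    D.idem • v = 0 := by
  obtain ⟨s, hs, hv⟩ := D.exists_unit_eq_idem_smul v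
  have : ∑ i, s i • v.1 i = 0 := by
    refine Subtype.ext ?_
    have h' := congrArg (D.idem • ·) h
    simp only [counit_apply, Finset.smul_sum, smul_zero] at h'
    rw [AddSubgroup.val_finsetSum, AddSubgroup.coe_zero, ← h']
    refine Finset.sum_congr rfl fun i _ => ?_
    rw [coe_smul, hs, mul_smul, mul_smul, D.idem_smul_coe]
  rw [← hv, this, map_zero]
  rfl

/-- A section σ of the counit onto its image agrees with the inverse on ε-fixed elements, because
the kernel is killed by ε. These elements generate Rε ⊗ εX, so σ is also a left inverse. -/
theorem counit_injective_of_projective_range (h : Module.Projective R (LinearMap.range (D.counit X))) :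
    Function.Injective (D.counit X) := by
  obtain ⟨σ, hσ⟩ := Module.projective_lifting_property (D.counit X).rangeRestrict LinearMap.id
    (D.counit X).surjective_rangeRestrict
  replace hσ : ∀ x, D.counit X (σ x) = x := fun x =>
    congrArg Subtype.val (LinearMap.congr_fun hσ x)
  have key : ∀ y : D.Fixed X,
      σ ((D.counit X).rangeRestrict (D.unit _ y).1) = (D.unit _ y).1 := by
    intro y
    have h0 : D.counit X ((D.unit _ y).1 - σ ((D.counit X).rangeRestrict (D.unit _ y).1)) = 0 := by
      rw [map_sub, hσ]
      exact sub_self _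
    have := D.idem_smul_eq_zero_of_counit_eq_zero h0
    rw [smul_sub, ← map_smul, ← map_smul, D.idem_smul_coe] at this
    exact (sub_eq_zero.1 this).symm
  have key' : ∀ v, σ ((D.counit X).rangeRestrict v) = v := by
    intro v
    conv_lhs => rw [← D.sum_basis_smul_unit v]
    simp only [map_sum, map_smul, key]
    exact D.sum_basis_smul_unit v
  rw [injective_iff_map_eq_zero]
  intro v hv
  rw [← key' v, show (D.counit X).rangeRestrict v = 0 from Subtype.ext hv, map_zero]

/-- By naturality, each coordinate map X ⟶ R sends the kernel of the counit of X into that of R, and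
the coordinates are jointly injective. -/
theorem counit_injective_of_embedding (h : Function.Injective (D.counit R)) {n : ℕ}
    (f : X →ₗ[R] (Fin n → R)) (hf : Function.Injective f) : Function.Injective (D.counit X) := by
  rw [injective_iff_map_eq_zero]
  intro v hv
  refine Subtype.ext <| funext fun i => Subtype.ext <| hf ?_
  rw [AddSubgroup.coe_zero, Pi.zero_apply, AddSubgroup.coe_zero, map_zero]
  funext k
  let g : X →ₗ[R] R := LinearMap.proj k ∘ₗ f
  obtain ⟨w, hw⟩ : ∃ w : D.Induced (D.Fixed R), ∀ i, (w.1 i : R) = g (v.1 i : X) :=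
    ⟨D.induced.map (D.fixed.map (M := ModuleCat.of R X) (N := ModuleCat.of R R) g) v, fun _ => rfl⟩
  have h0 : w = 0 := by
    refine h (Eq.trans ?_ (map_zero _).symm)
    have h1 := congrArg g hv
    rw [map_zero, counit_apply, map_sum] at h1
    rw [counit_apply, ← h1]
    exact Finset.sum_congr rfl fun i _ => by rw [hw, map_smul]
  have := hw i
  rw [h0] at this
  exact this.symm

end Counit

end CornerData

end Corner

/-! ### The kernel sequence of a composite -/

section ExactSequences

variable {R : Type u} [Ring R] {A B C : Type u} [AddCommGroup A] [Module R A] [AddCommGroup B]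
  [Module R B] [AddCommGroup C] [Module R C]

theorem isExt_ker_comp (g : A →ₗ[R] B) (p : B →ₗ[R] C) (hg : Function.Surjective g) :
    IsExt R (LinearMap.ker g) (LinearMap.ker (p ∘ₗ g)) (LinearMap.ker p) := by
  refine ⟨Submodule.inclusion fun x hx => ?_, g.restrict fun x hx => hx,
    Submodule.inclusion_injective _, fun y => ?_, fun y => ?_⟩
  · rw [LinearMap.mem_ker, LinearMap.comp_apply, LinearMap.mem_ker.1 hx, map_zero]
  · constructor
    · intro h
      exact ⟨⟨y.1, congrArg Subtype.val h⟩, rfl⟩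
    · rintro ⟨x, rfl⟩
      exact Subtype.ext x.2
  · obtain ⟨x, hx⟩ := hg y.1
    exact ⟨⟨x, by rw [LinearMap.mem_ker, LinearMap.comp_apply, hx]; exact y.2⟩, Subtype.ext hx⟩

end ExactSequences

/-! ### Noetherian corners, the trace RεX and modules over the quotient ring -/

namespace CornerData

variable {R S : Type u} [Ring R] [Ring S] (D : CornerData R S)

section Noetherian

variable (X : Type u) [AddCommGroup X] [Module R X]

theorem exists_mem_of_mem_span (N : Submodule S (D.Fixed X)) {x : X}
    (hx : x ∈ Submodule.span R ((↑) '' (N : Set (D.Fixed X)))) (r : R) :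
    ∃ y ∈ N, (y : X) = D.idem • r • x := by
  induction hx using Submodule.span_induction generalizing r with
  | mem x hx =>
    obtain ⟨y, hy, rfl⟩ := hx
    obtain ⟨s, hs⟩ := D.exists_ι r
    refine ⟨s • y, N.smul_mem s hy, ?_⟩
    rw [coe_smul, hs, mul_smul, mul_smul]
    congr 2
    exact D.idem_smul_coe y
  | zero => exact ⟨0, zero_mem _, by simp⟩
  | add x y _ _ hx hy =>
    obtain ⟨a, ha, ha'⟩ := hx r
    obtain ⟨b, hb, hb'⟩ := hy r
    exact ⟨a + b, add_mem ha hb, by simp [ha', hb']⟩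
  | smul c x _ hx =>
    obtain ⟨a, ha, ha'⟩ := hx (r * c)
    exact ⟨a, ha, by rw [ha', mul_smul]⟩

/-- A submodule N of εX is recovered from the R-submodule it spans, as N = ε(RN), so ascending
chains in εX embed into those of X. -/
instance isNoetherian_fixed [IsNoetherian R X] : IsNoetherian S (D.Fixed X) := by
  rw [isNoetherian_iff']
  have hm : StrictMono fun N : Submodule S (D.Fixed X) =>
      Submodule.span R ((↑) '' (N : Set (D.Fixed X)) : Set X) := by
    refine Monotone.strictMono_of_injective
      (fun N N' h => Submodule.span_mono (Set.image_mono h)) fun N N' h => ?_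
    have key : ∀ N N' : Submodule S (D.Fixed X),
        Submodule.span R ((↑) '' (N : Set (D.Fixed X)) : Set X) =
        Submodule.span R ((↑) '' (N' : Set (D.Fixed X)) : Set X) → N ≤ N' := by
      intro N N' h x hx
      obtain ⟨y, hy, hyx⟩ := D.exists_mem_of_mem_span X N'
        (h ▸ Submodule.subset_span ⟨x, hx, rfl⟩ : (x : X) ∈ _) 1
      rw [one_smul, D.idem_smul_coe] at hyx
      rwa [← Subtype.ext hyx]
    exact le_antisymm (key N N' h) (key N' N h.symm)
  exact hm.wellFoundedGT

include D in
theorem isNoetherianRing [IsNoetherianRing R] : IsNoetherianRing S := by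
  let f : S →ₗ[S] D.Fixed R :=
    { toFun := fun s => ⟨D.ι s, D.idem_mul_ι s⟩
      map_add' := fun a b => Subtype.ext (map_add D.ι a b)
      map_smul' := fun a b => Subtype.ext (map_mul D.ι a b) }
  exact isNoetherian_of_injective f fun a b h => D.ι_injective (congrArg Subtype.val h)

end Noetherian

section Trace

variable {X M : Type u} [AddCommGroup X] [Module R X] [AddCommGroup M] [Module R M]

/-- The submodule `R ε X` of `X`. -/
abbrev trace (X : Type u) [AddCommGroup X] [Module R X] : Submodule R X :=
  LinearMap.range (D.counit X)

theorem smul_mem_trace (r : R) (x : D.Fixed X) : r • (x : X) ∈ D.trace X :=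
  Submodule.smul_mem _ _ ⟨_, D.counit_unit x⟩

theorem idem_mem_trace : D.idem ∈ D.trace R := by
  have := D.smul_mem_trace 1 ⟨D.idem, D.idem_mul_idem⟩
  rwa [one_smul] at this

theorem map_eq_zero_of_mem_trace (hM : ∀ x : M, D.idem • x = 0) (f : X →ₗ[R] M) {x : X}
    (hx : x ∈ D.trace X) : f x = 0 := by
  obtain ⟨v, rfl⟩ := hx
  rw [counit_apply, map_sum]
  refine Finset.sum_eq_zero fun i _ => ?_
  rw [map_smul, ← D.idem_smul_coe (v.1 i), map_smul, hM, smul_zero]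

theorem smul_eq_zero_of_mem_trace {r : R} (hr : r ∈ D.trace R) (hM : ∀ x : M, D.idem • x = 0)
    (x : M) : r • x = 0 :=
  D.map_eq_zero_of_mem_trace hM (LinearMap.toSpanSingleton R M x) hr

theorem idem_smul_quotient (x : X ⧸ D.trace X) : D.idem • x = 0 := by
  obtain ⟨x, rfl⟩ := Submodule.mkQ_surjective _ x
  rw [← map_smul, Submodule.mkQ_apply, Submodule.Quotient.mk_eq_zero]
  have := D.smul_mem_trace 1 ⟨D.idem • x, D.idem_smul_mem x⟩
  rwa [one_smul] at this

theorem isExt_counit (h : Function.Injective (D.counit X)) :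
    IsExt R (D.Induced (D.Fixed X)) X (X ⧸ D.trace X) :=
  ⟨D.counit X, (D.trace X).mkQ, h, by
    rw [LinearMap.exact_iff, Submodule.ker_mkQ], Submodule.mkQ_surjective _⟩

/-- The counit is injective as soon as the trace ideal has a left unit. -/
theorem counit_injective_of_left_unit {f : R} (hf : f ∈ D.trace R)
    (hf' : ∀ y ∈ D.trace R, f * y = y) : Function.Injective (D.counit X) := by
  rw [injective_iff_map_eq_zero]
  intro v hv
  -- The module Rε ⊗ εX is generated by ε-fixed elements, on which coefficients may be taken in Rε,
  -- and f fixes these.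
  have h1 : f • v = v := by
    conv_lhs => rw [← D.sum_basis_smul_unit v]
    conv_rhs => rw [← D.sum_basis_smul_unit v]
    rw [Finset.smul_sum]
    refine Finset.sum_congr rfl fun i _ => ?_
    rw [← D.idem_smul_coe (D.unit _ (v.1 i)), smul_smul, smul_smul, mul_assoc,
      hf' _ (show D.basis i * D.idem ∈ D.trace R from
        Submodule.smul_mem (D.trace R) (D.basis i) D.idem_mem_trace), mul_smul]
  -- Write f = ∑ bᵢ wᵢ with wᵢ in εR. Then wᵢ v = ε(wᵢ v), and wᵢ v lies in the kernel of the
  -- counit, which ε kills; hence v = f v = 0.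
  obtain ⟨w, rfl⟩ := hf
  rw [← h1, counit_apply, Finset.sum_smul]
  refine Finset.sum_eq_zero fun i _ => ?_
  rw [← D.idem_smul_coe (w.1 i), smul_eq_mul, smul_eq_mul, mul_smul, mul_smul,
    D.idem_smul_eq_zero_of_counit_eq_zero (by rw [map_smul, hv, smul_zero]), smul_zero]

theorem counit_injective_of_finite_projective (h : Module.Projective R (D.trace R))
    {P : Type u} [AddCommGroup P] [Module R P] [Module.Finite R P] [Module.Projective R P]
    (f : X →ₗ[R] P) (hf : Function.Injective f) : Function.Injective (D.counit X) := by
  obtain ⟨n, g, hg⟩ := Module.Finite.exists_fin' R P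
  obtain ⟨s, hs⟩ := Module.projective_lifting_property g LinearMap.id hg
  have hs' : Function.Injective s :=
    Function.LeftInverse.injective (g := g) (LinearMap.congr_fun hs)
  exact D.counit_injective_of_embedding (D.counit_injective_of_projective_range h) (s ∘ₗ f)
    (hs'.comp hf)

/-- The counit identifies RεQ with Rε ⊗ εQ, which lies in `add (Rε ⊗ εR)`, and Rε ⊗ εR ≅ RεR is
projective. -/
theorem trace_projective (h : Module.Projective R (D.trace R)) (Q : Type u) [AddCommGroup Q]
    [Module R Q] [Module.Finite R Q] [Module.Projective R Q] :
    Module.Projective R (D.trace Q) := by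
  have h1 : MemAdd R (D.Induced (D.Fixed R)) (D.Induced (D.Fixed Q)) :=
    D.induced.memAdd (U := ModuleCat.of S (D.Fixed R)) (M := ModuleCat.of S (D.Fixed Q))
      (D.fixed.memAdd (U := ModuleCat.of R R) (M := ModuleCat.of R Q)
        (MemAdd.of_projective (R := R) (M := Q)))
  have := Module.Projective.of_equiv'
    (LinearEquiv.ofInjective _ (D.counit_injective_of_projective_range h)).symm
  have := h1.projective
  exact Module.Projective.of_equiv' (LinearEquiv.ofInjective _
    (D.counit_injective_of_finite_projective h (LinearMap.id : Q →ₗ[R] Q)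
      Function.injective_id))

end Trace

section Quotient

variable {T : Type u} [Ring T] {π : R →+* T}

/-- A linear map over `R` between modules over a quotient ring is linear over the quotient ring. -/
noncomputable def _root_.LinearMap.ofRestrict (hπ : Function.Surjective π) {M N : ModuleCat.{u} T}
    (f : (ExactAddFunctor.restrict π).obj M →ₗ[R] (ExactAddFunctor.restrict π).obj N) :
    M →ₗ[T] N where
  toFun := f
  map_add' := f.map_add
  map_smul' t x := by
    obtain ⟨r, rfl⟩ := hπ t
    exact f.map_smul r x

theorem _root_.IsExt.of_restrict (hπ : Function.Surjective π) {A B C : ModuleCat.{u} T}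
    (h : IsExt R ((ExactAddFunctor.restrict π).obj A) ((ExactAddFunctor.restrict π).obj B)
      ((ExactAddFunctor.restrict π).obj C)) : IsExt T A B C := by
  obtain ⟨f, g, hf, hfg, hg⟩ := h
  exact ⟨f.ofRestrict hπ, g.ofRestrict hπ, hf, hfg, hg⟩

variable (hπ : Function.Surjective π) (hker : ∀ x, π x = 0 ↔ x ∈ D.trace R)

include hker in
theorem idem_smul_restrict (M : ModuleCat.{u} T) (x : (ExactAddFunctor.restrict π).obj M) :
    D.idem • x = 0 := by
  have : π D.idem = 0 := (hker _).2 D.idem_mem_trace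
  change π D.idem • (show M from x) = 0
  rw [this, zero_smul]

include hπ hker in
theorem exists_restrict_equiv (M : Type u) [AddCommGroup M] [Module R M]
    (hM : ∀ x : M, D.idem • x = 0) :
    ∃ N : ModuleCat.{u} T, Nonempty ((ExactAddFunctor.restrict π).obj N ≃ₗ[R] M) := by
  let _ : SMul T M := ⟨fun t x => Function.surjInv hπ t • x⟩
  have hsmul : ∀ (r : R) (x : M), π r • x = r • x := by
    intro r x
    change Function.surjInv hπ (π r) • x = r • x
    rw [← sub_eq_zero, ← sub_smul]
    refine D.smul_eq_zero_of_mem_trace ((hker _).1 ?_) hM x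
    rw [map_sub, Function.surjInv_eq hπ, sub_self]
  let _ : Module T M := Function.Surjective.moduleLeft π hπ hsmul
  exact ⟨ModuleCat.of T M, ⟨{ AddEquiv.refl M with map_smul' := hsmul }⟩⟩

include hπ hker in
-- Q/RεQ is the base change of Q to T: a lift from Q to a T-module kills RεQ, hence descends to the
-- quotient.
theorem projective_of_equiv_quotient (Q : Type u) [AddCommGroup Q] [Module R Q]
    [Module.Projective R Q] (N : ModuleCat.{u} T)
    (a : (ExactAddFunctor.restrict π).obj N ≃ₗ[R] (Q ⧸ D.trace Q)) : Module.Projective T N := by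
  refine Module.Projective.of_lifting_property'' fun f hf => ?_
  let F := ModuleCat.of T (N →₀ T)
  let f' : (ExactAddFunctor.restrict π).obj F →ₗ[R] (ExactAddFunctor.restrict π).obj N :=
    (ExactAddFunctor.restrict π).map (M := F) (N := N) f
  have hf' : Function.Surjective f' := hf
  obtain ⟨g, hg⟩ := Module.projective_lifting_property f'
    (a.symm.toLinearMap ∘ₗ (D.trace Q).mkQ) hf'
  let h := (D.trace Q).liftQ g fun x hx =>
    D.map_eq_zero_of_mem_trace (D.idem_smul_restrict hker F) g hx
  refine ⟨LinearMap.ofRestrict hπ (M := N) (N := F) (h ∘ₗ a.toLinearMap),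
    LinearMap.ext fun x => ?_⟩
  obtain ⟨y, rfl⟩ := a.symm.surjective x
  obtain ⟨z, rfl⟩ := Submodule.mkQ_surjective _ y
  have h1 : f' (h (a (a.symm ((D.trace Q).mkQ z)))) = a.symm ((D.trace Q).mkQ z) := by
    rw [LinearEquiv.apply_symm_apply]
    exact LinearMap.congr_fun hg z
  exact h1

include hπ hker in
/-- Syzygies over `R` of modules over the quotient ring. -/
theorem exists_syzOf_quotient [IsNoetherianRing R] (h : Module.Projective R (D.trace R))
    (n j : ℕ) {K : Type u} [AddCommGroup K] [Module R K] (Y : ModuleCat.{u} T)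
    (hK : SyzOf R (n + (j + 1)) K ((ExactAddFunctor.restrict π).obj Y)) :
    ∃ (Z : ModuleCat.{u} T) (P : ModuleCat.{u} R), Module.Finite R P ∧ Module.Projective R P ∧
      SyzOf T n Z Y ∧ SyzOf R (j + 1) (K × P) ((ExactAddFunctor.restrict π).obj Z) := by
  induction n generalizing K Y with
  | zero =>
    rw [zero_add] at hK
    exact ⟨Y, ModuleCat.of R PUnit.{u + 1}, inferInstanceAs (Module.Finite R PUnit.{u + 1}),
      inferInstanceAs (Module.Projective R PUnit.{u + 1}), ⟨.refl T Y⟩,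
      hK.congr LinearEquiv.prodUnique.symm (.refl R _)⟩
  | succ n ih =>
    rw [Nat.add_right_comm] at hK
    obtain ⟨Q, C, hQ, hQ', ⟨f, g, hf, hfg, hg⟩, hS⟩ := hK
    let p : (Q ⧸ D.trace Q) →ₗ[R] (ExactAddFunctor.restrict π).obj Y :=
      (D.trace Q).liftQ g fun x hx =>
        D.map_eq_zero_of_mem_trace (D.idem_smul_restrict hker Y) g hx
    have hpg : p ∘ₗ (D.trace Q).mkQ = g := Submodule.liftQ_mkQ _ _ _
    have hp : Function.Surjective p := fun y => by
      obtain ⟨x, rfl⟩ := hg y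
      exact ⟨(D.trace Q).mkQ x, LinearMap.congr_fun hpg x⟩
    -- This is 0 → RεQ → C → Z → 0, relating the R-syzygy C of Y to its T-syzygy Z. As RεQ is
    -- projective, its syzygies of positive order can be taken zero, so further syzygies of C and Z
    -- agree up to a projective; the surplus j + 1 keeps the order positive.
    have hE := isExt_ker_comp (D.trace Q).mkQ p (Submodule.mkQ_surjective _)
    rw [hpg, Submodule.ker_mkQ] at hE
    replace hE := hE.congr (.refl R _) ((LinearEquiv.ofEq _ _ (LinearMap.exact_iff.1 hfg)).trans
      (LinearEquiv.ofInjective f hf).symm) (.refl R _)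
    obtain ⟨Q', ⟨a⟩⟩ := D.exists_restrict_equiv hπ hker (Q ⧸ D.trace Q) D.idem_smul_quotient
    obtain ⟨Z, ⟨b⟩⟩ := D.exists_restrict_equiv hπ hker (LinearMap.ker p)
      fun x => Subtype.ext (D.idem_smul_quotient x.1)
    have := D.trace_projective h Q
    have hQZ : IsExt T Z Q' Y :=
      IsExt.of_restrict hπ ((isExt_ker p hp).congr b.symm a.symm (.refl R _))
    have hfin : Module.Finite T Q' :=
      (ExactAddFunctor.finite_restrict hπ).1 (Module.Finite.equiv a.symm)
    obtain ⟨C', P, hP, hP', hC', hE'⟩ := SyzOf.horseshoe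
      (hE.congr (.refl R _) (.refl R _) b.symm) (SyzOf.punit_succ (n + j) (D.trace Q)) hS
    obtain ⟨c⟩ := hE'.equiv_of_subsingleton_left
    obtain ⟨Z', P', _, _, h1, h2⟩ := ih Z (hC'.congr c.symm (.refl R _))
    exact ⟨Z', ModuleCat.of R (P × P'), inferInstanceAs (Module.Finite R (P × P')),
      inferInstanceAs (Module.Projective R (P × P')),
      ⟨Q', Z, hfin, D.projective_of_equiv_quotient hπ hker Q Q' a, hQZ, h1⟩,
      h2.congr (LinearEquiv.prodAssoc R _ _ _) (.refl R _)⟩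

end Quotient

end CornerData

/-! ### Transfer of the Igusa–Todorov property between R, the corner and the quotient -/

namespace CornerData

variable {R S T : Type u} [Ring R] [Ring S] [Ring T] (D : CornerData R S) {π : R →+* T}

variable [IsNoetherianRing R]

theorem finite_fixed (X : ModuleCat.{u} R) [Module.Finite R X] :
    Module.Finite S (D.fixed.obj X) :=
  have : IsNoetherian R X := isNoetherian_of_isNoetherianRing_of_finite R X
  inferInstanceAs (Module.Finite S (D.Fixed X))

/-- Induction carries a j-th syzygy of εX and its resolution over S to a j-th syzygy of Rε ⊗ εX and
a resolution over R. -/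
theorem exists_hasRes_induced {n j : ℕ} (hS : IsITCat S n j) :
    ∃ V : ModuleCat.{u} R, Module.Finite R V ∧ ∀ X : ModuleCat.{u} R, Module.Finite R X →
      ∃ Y : ModuleCat.{u} R, SyzOf R j Y (D.Induced (D.Fixed X)) ∧ HasRes R V n Y := by
  have := D.isNoetherianRing
  rw [isITCat_iff] at hS
  obtain ⟨V, hV, h⟩ := hS
  refine ⟨D.induced.obj V, D.induced.finite D.induced_self hV, fun X hX => ?_⟩
  have := D.finite_fixed X
  obtain ⟨Y, -, hY⟩ := exists_syzOf (R := S) j (D.fixed.obj X)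
  exact ⟨D.induced.obj Y, D.induced.syzOf D.induced_self hY, D.induced.hasRes (h Y _ this hY)⟩

include D in
/-- The Igusa–Todorov property passes to the corner. -/
theorem isITCat_corner {m n : ℕ} (h : IsITCat R m n) : IsITCat S m n := by
  have := D.isNoetherianRing
  rw [isITCat_iff] at h ⊢
  obtain ⟨U, hU, h⟩ := h
  refine ⟨D.fixed.obj U, D.finite_fixed U, fun K X hX hK => ?_⟩
  -- The induced module Rε ⊗ K is again an n-th syzygy, and cutting its resolution back by ε returns
  -- K through the unit.
  have h1 := h (D.induced.obj K) (D.induced.obj X) (D.induced.finite D.induced_self hX)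
    (D.induced.syzOf D.induced_self hK)
  exact (D.fixed.hasRes h1).congr (LinearEquiv.ofBijective _ (D.unit_bijective (Y := K))).symm

/-- The common core of the bounds for projective RεR. In V × W × R, the factor V resolves the
induced part, W resolves (n+1)-st R-syzygies of modules resolved by T, and R accounts for the
projectives. -/
theorem exists_hasRes (hπ : Function.Surjective π) (hker : ∀ x, π x = 0 ↔ x ∈ D.trace R)
    (hD : Module.Projective R (D.trace R)) {m n j : ℕ} (hT : IsITCat T m j) (hS : IsITCat S n j) :
    ∃ U : ModuleCat.{u} R, Module.Finite R U ∧ MemAdd R U R ∧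
      ∀ K X : ModuleCat.{u} R, Module.Finite R X → Function.Injective (D.counit X) →
        SyzOf R j K X → HasRes R U (m + n + 1) K := by
  obtain ⟨V, hV, h⟩ := D.exists_hasRes_induced hS
  have : IsNoetherianRing T := isNoetherianRing_of_surjective R T π hπ
  rw [isITCat_iff] at hT
  obtain ⟨U, hU, h'⟩ := hT
  have := (ExactAddFunctor.finite_restrict hπ).2 hU
  obtain ⟨W, hW, h''⟩ := HasRes.exists_syzygy (R := R) (n + 1) ((ExactAddFunctor.restrict π).obj U)
  have hself : MemAdd R (V × W × R) (V × W × R) := .refl _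
  have hR : MemAdd R (V × W × R) R := hself.snd_of_prod.snd_of_prod
  refine ⟨ModuleCat.of R (V × W × R), inferInstanceAs (Module.Finite R (V × W × R)), hR,
    fun K X hX hinj hK => ?_⟩
  obtain ⟨Y, hY, hY'⟩ := h X hX
  obtain ⟨C, P, _, _, hC, hE⟩ := SyzOf.horseshoe (D.isExt_counit hinj) hY hK
  have hCfin := hC.finite
  -- Order n + 1 is what splicing with a length-n resolution of Y requires. In total L is a syzygy
  -- of order j + (n + 1) of a T-module: j steps are traded for T-syzygies, and n + 1 remain over R.
  obtain ⟨L, -, hL⟩ := exists_syzOf (R := R) (n + 1) C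
  obtain ⟨N, ⟨a⟩⟩ := D.exists_restrict_equiv hπ hker (X ⧸ D.trace X) D.idem_smul_quotient
  have hN : Module.Finite T N :=
    (ExactAddFunctor.finite_restrict hπ).1 (Module.Finite.equiv a.symm)
  obtain ⟨Z, P', _, _, hZ, hZ'⟩ := D.exists_syzOf_quotient hπ hker hD j n N
    ((hC.trans hL).congr (.refl R _) a.symm)
  have hL' : HasRes R W m (L × P') := h'' m _ (ModuleCat.of R (L × P'))
    ((ExactAddFunctor.restrict π).hasRes (h' Z N hN hZ)) hZ'
  have hL'' : HasRes R (V × W × R) m L :=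
    (hL'.mono hself.snd_of_prod.fst_of_prod le_rfl).fst_of_prod (hR.trans .of_projective)
  exact ((hY'.mono hself.fst_of_prod le_rfl).extension hR hE hL hL'').fst_of_prod
    (hR.trans .of_projective)

theorem isITCat_of_projective_trace (hπ : Function.Surjective π)
    (hker : ∀ x, π x = 0 ↔ x ∈ D.trace R) (hD : Module.Projective R (D.trace R)) {m n j : ℕ}
    (hT : IsITCat T m j) (hS : IsITCat S n j) : IsITCat R (m + n + 2) j := by
  obtain ⟨U, hU, -, h⟩ := D.exists_hasRes hπ hker hD hT hS
  -- Passing to first syzygies, which embed in projectives and so have injective counit, raises j by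
  -- one; trading this back costs the extra step of length.
  refine isITCat_of_succ (isITCat_iff.2 ⟨U, hU, fun K X hX hK => ?_⟩)
  obtain ⟨P, X', hP, hP', hE, hS⟩ := hK
  have hX' := hE.finite_left
  obtain ⟨f, -, hf, -⟩ := hE
  exact h K X' hX' (D.counit_injective_of_finite_projective hD f hf) hS

theorem isITCat_of_left_unit (hπ : Function.Surjective π)
    (hker : ∀ x, π x = 0 ↔ x ∈ D.trace R) (hD : Module.Projective R (D.trace R)) {f : R}
    (hf : f ∈ D.trace R) (hf' : ∀ y ∈ D.trace R, f * y = y) {m n j : ℕ}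
    (hT : IsITCat T m j) (hS : IsITCat S n j) : IsITCat R (m + n + 1) j := by
  obtain ⟨U, hU, -, h⟩ := D.exists_hasRes hπ hker hD hT hS
  exact isITCat_iff.2 ⟨U, hU, fun K X hX hK => h K X hX (D.counit_injective_of_left_unit hf hf') hK⟩

/-- Here the counit need not be injective. The sequence for its kernel makes a syzygy of RεX a
quotient by a projective, costing one step; the sequence for its cokernel splits on j-th syzygies
and costs nothing. -/
theorem isITCat_of_projective_syzygy (hπ : Function.Surjective π)
    (hker : ∀ x, π x = 0 ↔ x ∈ D.trace R) {n j : ℕ}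
    (hT : ∀ (Y : ModuleCat.{u} T) (K : ModuleCat.{u} R), Module.Finite T Y →
      SyzOf R j K ((ExactAddFunctor.restrict π).obj Y) → Module.Projective R K)
    (hS : IsITCat S n j) : IsITCat R (n + 1) j := by
  obtain ⟨V, hV, h⟩ := D.exists_hasRes_induced hS
  have hself : MemAdd R (V × R) (V × R) := .refl _
  have hR : MemAdd R (V × R) R := hself.snd_of_prod
  rw [isITCat_iff]
  refine ⟨ModuleCat.of R (V × R), inferInstanceAs (Module.Finite R (V × R)), fun K X hX hK => ?_⟩
  have hproj : ∀ (M : Type u) [AddCommGroup M] [Module R M], Module.Finite R M →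
      (∀ x : M, D.idem • x = 0) → ∀ L : ModuleCat.{u} R, SyzOf R j L M → Module.Projective R L := by
    intro M _ _ _ hM L hL
    obtain ⟨N, ⟨a⟩⟩ := D.exists_restrict_equiv hπ hker M hM
    exact hT N L ((ExactAddFunctor.finite_restrict hπ).1 (Module.Finite.equiv a.symm))
      (hL.congr (.refl R _) a.symm)
  obtain ⟨Y, hY, hY'⟩ := h X hX
  have : Module.Finite R (D.Induced (D.Fixed X)) :=
    D.induced.finite D.induced_self (D.finite_fixed X)
  have : Module.Finite R (LinearMap.ker (D.counit X)) :=
    (isExt_ker _ (D.counit X).surjective_rangeRestrict).congr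
      (LinearEquiv.ofEq _ _ (LinearMap.ker_rangeRestrict _)) (.refl R _) (.refl R _) |>.finite_left
  obtain ⟨L, hL, hL'⟩ := exists_syzOf (R := R) j (LinearMap.ker (D.counit X))
  have := hproj _ this (fun x => Subtype.ext (D.idem_smul_eq_zero_of_counit_eq_zero x.2)) L hL'
  have hE₁ : IsExt R (LinearMap.ker (D.counit X)) (D.Induced (D.Fixed X)) (D.trace X) :=
    (isExt_ker _ (D.counit X).surjective_rangeRestrict).congr
      (LinearEquiv.ofEq _ _ (LinearMap.ker_rangeRestrict _)) (.refl R _) (.refl R _)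
  obtain ⟨C, P, _, _, hC, hE₂⟩ := SyzOf.horseshoe hE₁ hL' hY
  have hC' : HasRes R (V × R) (n + 1) C := HasRes.quotient hR hE₂
    ((hY'.mono hself.fst_of_prod le_rfl).prod_memAdd (hR.trans .of_projective))
  have hE₃ : IsExt R (D.trace X) X (X ⧸ D.trace X) :=
    (isExt_ker _ (D.trace X).mkQ_surjective).congr (LinearEquiv.ofEq _ _ (Submodule.ker_mkQ _))
      (.refl R _) (.refl R _)
  obtain ⟨C', P', _, _, hC₁, hE₄⟩ := SyzOf.horseshoe hE₃ hC hK
  have := hproj _ inferInstance D.idem_smul_quotient C' hC₁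
  have := hC₁.finite
  obtain ⟨a⟩ := hE₄.nonempty_equiv_prod
  exact ((hC'.prod_memAdd (hR.trans .of_projective)).congr a.symm).fst_of_prod
    (hR.trans .of_projective)

end CornerData

/-! ### Syzygy-finite algebras -/

section SyzygyFinite

variable {R : Type u} [Ring R]

open CategoryTheory in
-- Summands of K are represented as quotients K/A, and Noetherian induction runs over A: a
-- nontrivial decomposition of K/A gives two quotients by strictly larger submodules.
theorem MemAdd.of_indecomposable {U K : ModuleCat.{u} R} [IsNoetherian R K]
    (h : ∀ M : ModuleCat.{u} R, Indecomposable M →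
      (∃ N : ModuleCat.{u} R, Nonempty ((M × N) ≃ₗ[R] K)) → MemAdd R U M) :
    MemAdd R U K := by
  have key : ∀ A : Submodule R K, (∃ N : ModuleCat.{u} R, Nonempty (((K ⧸ A) × N) ≃ₗ[R] K)) →
      MemAdd R U (K ⧸ A) := by
    intro A
    induction A using IsNoetherian.induction with
    | hgt A ih =>
      rintro ⟨N, ⟨a⟩⟩
      by_cases h0 : Subsingleton (K ⧸ A)
      · exact MemAdd.of_subsingleton
      by_cases hind : Indecomposable (ModuleCat.of R (K ⧸ A))
      · exact h _ hind ⟨N, ⟨a⟩⟩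
      have hzero : ¬ Limits.IsZero (ModuleCat.of R (K ⧸ A)) := fun hz =>
        h0 (ModuleCat.subsingleton_of_isZero hz)
      simp only [Indecomposable, hzero, not_false_eq_true, true_and, not_forall, not_or] at hind
      obtain ⟨Y, Z, i, hY, hZ⟩ := hind
      let b : (K ⧸ A) ≃ₗ[R] (Y × Z) := (i ≪≫ ModuleCat.biprodIsoProd Y Z).toLinearEquiv
      have part : ∀ Y Z : ModuleCat.{u} R, ¬ Limits.IsZero Z → ((K ⧸ A) ≃ₗ[R] (Y × Z)) →
          MemAdd R U Y := by
        intro Y Z hZ b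
        let q : K →ₗ[R] Y := LinearMap.fst R Y Z ∘ₗ b.toLinearMap ∘ₗ A.mkQ
        have hq : Function.Surjective q :=
          Prod.fst_surjective.comp (b.surjective.comp A.mkQ_surjective)
        let c : (K ⧸ LinearMap.ker q) ≃ₗ[R] Y := q.quotKerEquivOfSurjective hq
        have hle : A ≤ LinearMap.ker q := fun x hx => by
          have : A.mkQ x = 0 := (Submodule.Quotient.mk_eq_zero A).2 hx
          simp only [q, LinearMap.mem_ker, LinearMap.comp_apply, this, map_zero]
        have hne : A ≠ LinearMap.ker q := by
          intro hA
          refine hZ ?_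
          have : Subsingleton Z := by
            refine ⟨fun z z' => ?_⟩
            have hz : ∀ z : Z, z = 0 := by
              intro z
              obtain ⟨y, hy⟩ := b.surjective (0, z)
              obtain ⟨x, rfl⟩ := A.mkQ_surjective y
              have hx : x ∈ A := by
                rw [hA, LinearMap.mem_ker]
                exact congrArg Prod.fst hy
              have h1 : A.mkQ x = 0 := (Submodule.Quotient.mk_eq_zero A).2 hx
              rw [h1, map_zero] at hy
              exact (congrArg Prod.snd hy).symm
            rw [hz z, hz z']
          exact ModuleCat.isZero_of_subsingleton Z
        refine (ih _ (lt_of_le_of_ne hle hne) ⟨ModuleCat.of R (Z × N), ⟨?_⟩⟩).of_equiv c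
        exact ((c.prodCongr (.refl R (Z × N))).trans (LinearEquiv.prodAssoc R Y Z N).symm).trans
          ((b.symm.prodCongr (.refl R N)).trans a)
      exact ((part Y Z hZ b).prod
        (part Z Y hY (b.trans (LinearEquiv.prodComm R Y Z)))).of_equiv b.symm
  exact (key ⊥ ⟨ModuleCat.of R PUnit.{u + 1}, ⟨LinearEquiv.prodUnique.trans
    (Submodule.quotEquivOfEqBot ⊥ rfl)⟩⟩).of_equiv (Submodule.quotEquivOfEqBot ⊥ rfl)

theorem isITCat_of_isSyzygyFiniteAt {Γ : Type u} [Ring Γ] [IsNoetherianRing Γᵐᵒᵖ] {n : ℕ}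
    (h : IsSyzygyFiniteAt Γ n) : IsITCat Γᵐᵒᵖ 0 n := by
  obtain ⟨k, L, hL⟩ := h
  -- The listed modules are not required to be finitely generated. Those that are not are replaced
  -- by zero; this is harmless, as they are not isomorphic to summands of syzygies.
  have hL' : ∀ j, ∃ M : ModuleCat.{u} Γᵐᵒᵖ, Module.Finite Γᵐᵒᵖ M ∧
      (Module.Finite Γᵐᵒᵖ (L j) → M = L j) := by
    intro j
    by_cases hj : Module.Finite Γᵐᵒᵖ (L j)
    · exact ⟨L j, hj, fun _ => rfl⟩
    · exact ⟨ModuleCat.of Γᵐᵒᵖ PUnit.{u + 1}, inferInstanceAs (Module.Finite Γᵐᵒᵖ PUnit.{u + 1}),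
        fun h => absurd h hj⟩
  choose L' hfin hL' using hL'
  refine isITCat_iff.2 ⟨ModuleCat.of Γᵐᵒᵖ (∀ j, L' j),
    inferInstanceAs (Module.Finite Γᵐᵒᵖ (∀ j, L' j)), fun K X hX hK => ?_⟩
  have hKfin := hK.finite
  have : IsNoetherian Γᵐᵒᵖ K := isNoetherian_of_isNoetherianRing_of_finite _ _
  refine MemAdd.of_indecomposable fun M hM => ?_
  rintro ⟨N, ⟨a⟩⟩
  obtain ⟨j, ⟨b⟩⟩ := hL M hM ⟨K, N, ⟨hKfin, X, hX, (isSyzygyOf_iff hX).2 hK⟩, ⟨a⟩⟩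
  have hMfin : Module.Finite Γᵐᵒᵖ (L j) :=
    Module.Finite.of_surjective (b.toLinearMap ∘ₗ LinearMap.fst _ M N ∘ₗ a.symm.toLinearMap)
      (b.surjective.comp (Prod.fst_surjective.comp a.symm.surjective))
  have hj : L' j = L j := hL' j hMfin
  have h1 : MemAdd Γᵐᵒᵖ (∀ j, L' j) (L' j) :=
    (MemAdd.refl (R := Γᵐᵒᵖ) (∀ j, L' j)).of_retract (LinearMap.single Γᵐᵒᵖ (fun j => L' j) j)
      (LinearMap.proj j) (by ext; simp)
  rw [hj] at h1
  exact h1.of_equiv b.symm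

end SyzygyFinite

/-! ### Projective dimension and syzygies -/

section ProjectiveDimension

open CategoryTheory

variable {R : Type u} [Ring R]

/-- Dimension shifting; the bound n + 1 is strict, so it expresses projective dimension at most n.
-/
theorem SyzOf.projective_of_hasProjectiveDimensionLT {n : ℕ} {K : Type u} [AddCommGroup K]
    [Module R K] {X : ModuleCat.{u} R} (h : SyzOf R n K X)
    (hX : HasProjectiveDimensionLT X (n + 1)) : Module.Projective R K := by
  induction n generalizing X with
  | zero =>
    obtain ⟨a⟩ := h
    rw [← projective_iff_hasProjectiveDimensionLT_one, ← IsProjective.iff_projective] at hX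
    exact Module.Projective.of_equiv' a.symm
  | succ n ih =>
    obtain ⟨P, X', hP, hP', ⟨f, g, hf, hfg, hg⟩, hS⟩ := h
    let S := ModuleCat.shortComplexOfCompEqZero f g hfg.linearMap_comp_eq_zero
    have hS' : S.ShortExact := ModuleCat.shortComplex_shortExact S hfg hf hg
    exact ih hS ((hS'.hasProjectiveDimensionLT_X₃_iff n
      ((IsProjective.iff_projective (P : Type u)).1 hP')).1 hX)

end ProjectiveDimension

/-! ### The Igusa–Todorov distance is attained when finite -/

section Distance

variable {Γ : Type u} [Ring Γ]

theorem ITDist_le {m n : ℕ} (h : IsITAlgebra Γ m n) : ITDist Γ ≤ m :=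
  iInf₂_le m ⟨n, h⟩

theorem ITDist_eq_top_or_exists (Γ : Type u) [Ring Γ] :
    ITDist Γ = ⊤ ∨ ∃ m n : ℕ, IsITAlgebra Γ m n ∧ ITDist Γ = m := by
  classical
  by_cases h : ∃ m n : ℕ, IsITAlgebra Γ m n
  · obtain ⟨n, hn⟩ := Nat.find_spec h
    exact Or.inr ⟨Nat.find h, n, hn, le_antisymm (ITDist_le hn)
      (le_iInf₂ fun m hm => Nat.cast_le.2 (Nat.find_min' h hm))⟩
  · exact Or.inl (iInf₂_eq_top.2 fun m hm => absurd ⟨m, hm⟩ h)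

end Distance

/-! ### The corner data attached to e and the ideal ΛeΛ -/

section Concrete

open MulOpposite

variable {Λ : Type u} [Ring Λ] {e : Λ} (he : IsIdempotentElem e)

theorem finite_idemRight {k : Type*} [CommRing k] [Algebra k Λ] [Module.Finite k Λ] :
    Module.Finite he.Corner (IdemRight e) := by
  obtain ⟨s, hs⟩ := Module.Finite.fg_top (R := k) (M := Λ)
  let g : Λ → IdemRight e := fun x => ⟨e * x, x, rfl⟩
  have hg : ∀ x y, g (x + y) = g x + g y := fun x y => Subtype.ext (mul_add e x y)
  have hmem : ∀ x, g x ∈ Submodule.span he.Corner (g '' s) := by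
    intro x
    have hx : x ∈ Submodule.span k (s : Set Λ) := hs ▸ Submodule.mem_top
    induction hx using Submodule.span_induction with
    | mem y hy => exact Submodule.subset_span ⟨y, hy, rfl⟩
    | zero =>
      rw [show g 0 = 0 from Subtype.ext (mul_zero e)]
      exact zero_mem _
    | add y z _ _ hy hz =>
      rw [hg]
      exact add_mem hy hz
    | smul c y _ hy =>
      -- The scalar c acts on eΛ as the corner element c • e, so k-generators of Λ give
      -- eΛe-generators of eΛ.
      let b : he.Corner := ⟨c • e, (Subsemigroup.mem_corner_iff he).2
        ⟨by rw [mul_smul_comm, he.eq], by rw [smul_mul_assoc, he.eq]⟩⟩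
      rw [show g (c • y) = b • g y from Subtype.ext (by
        change e * c • y = (c • e) * (e * y)
        rw [mul_smul_comm, smul_mul_assoc, ← mul_assoc, he.eq])]
      exact Submodule.smul_mem _ b hy
  refine ⟨Submodule.fg_def.2 ⟨g '' s, s.finite_toSet.image g, eq_top_iff.2 ?_⟩⟩
  rintro ⟨_, x, rfl⟩ -
  exact hmem x

/-- The corner `eΛe` and a finite dual basis of `eΛ`, in terms of opposite rings. -/
theorem exists_cornerData [Module.Finite he.Corner (IdemRight e)]
    (hproj : Module.Projective he.Corner (IdemRight e)) :
    ∃ D : CornerData Λᵐᵒᵖ he.Cornerᵐᵒᵖ, D.idem = op e := by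
  obtain ⟨n, f, hf⟩ := Module.Finite.exists_fin' he.Corner (IdemRight e)
  -- The dual basis consists of the images under f of the standard vectors, with the components of
  -- the splitting s as coordinates.
  obtain ⟨s, hs⟩ := Module.projective_lifting_property f LinearMap.id hf
  replace hs : ∀ x, f (s x) = x := LinearMap.congr_fun hs
  let g : Λ → IdemRight e := fun x => ⟨e * x, x, rfl⟩
  let v : IdemRight e →+ Λ := (AddMonoidHom.mulLeft e).range.subtype
  have hv : ∀ (b : he.Corner) x, v (b • x) = b.1 * v x := fun _ _ => rfl
  refine ⟨{ ι := { toFun := fun b => op b.unop.1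
                   map_mul' := fun _ _ => rfl
                   map_zero' := rfl
                   map_add' := fun _ _ => rfl }
            ι_injective := fun a b h => unop_injective (Subtype.ext (op_injective h))
            exists_ι := fun x => ⟨op ⟨e * x.unop * e, x.unop, rfl⟩, ?_⟩
            size := n
            basis := fun i => op (v (f (Pi.single i 1)))
            coord := fun i =>
              { toFun := fun x => op (s (g x.unop) i)
                map_zero' := ?_
                map_add' := fun x y => ?_ }
            coord_mul := fun i x b => ?_
            sum_coord := fun x => ?_ }, rfl⟩
  · apply unop_injective
    change e * x.unop * e = e * (x.unop * e)
    rw [mul_assoc]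
  · rw [show g (unop 0) = 0 from Subtype.ext (mul_zero e), map_zero]
    rfl
  · rw [show g (unop (x + y)) = g x.unop + g y.unop from Subtype.ext (mul_add e _ _), map_add]
    rfl
  · change op (s (g (b.unop.1 * x.unop)) i) = op (s (g x.unop) i) * b
    have hb := (Subsemigroup.mem_corner_iff he).1 b.unop.2
    rw [show g (b.unop.1 * x.unop) = b.unop • g x.unop from Subtype.ext (by
      change e * (b.unop.1 * x.unop) = b.unop.1 * (e * x.unop)
      rw [← mul_assoc, ← mul_assoc, hb.1, hb.2]), map_smul]
    rfl
  · apply unop_injective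
    rw [Finset.unop_sum]
    change ∑ i, (s (g x.unop) i).1 * v (f (Pi.single i 1)) = e * x.unop
    have h1 : s (g x.unop) = ∑ i, s (g x.unop) i • Pi.single i (1 : he.Corner) := by
      funext j
      simp [Finset.sum_apply, Pi.single_apply]
    have h2 := congrArg v (hs (g x.unop))
    rw [h1] at h2
    simp only [map_sum, map_smul, hv] at h2
    exact h2

variable {he} {D : CornerData Λᵐᵒᵖ he.Cornerᵐᵒᵖ} (hD : D.idem = op e)

include hD

theorem op_mem_trace_iff (x : Λ) : op x ∈ D.trace Λᵐᵒᵖ ↔ x ∈ idemIdeal e := by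
  constructor
  · rintro ⟨w, hw⟩
    have hx : x = unop (D.counit Λᵐᵒᵖ w) := by rw [hw, unop_op]
    rw [hx, D.counit_apply, Finset.unop_sum]
    refine sum_mem fun i _ => ?_
    rw [← D.idem_smul_coe (w.1 i), hD, smul_eq_mul, smul_eq_mul, unop_mul, unop_mul, unop_op]
    exact (idemIdeal e).mul_mem_right _ _
      ((idemIdeal e).mul_mem_left _ _ (TwoSidedIdeal.subset_span rfl))
  · intro hx
    rw [idemIdeal, TwoSidedIdeal.mem_span_iff_mem_addSubgroup_closure] at hx
    induction hx using AddSubgroup.closure_induction with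
    | mem y hy =>
      obtain ⟨_, ⟨a, -, _, rfl, rfl⟩, b, -, rfl⟩ := hy
      have := D.smul_mem_trace (op b) ⟨D.idem • op a, D.idem_smul_mem (op a)⟩
      change op b • D.idem • op a ∈ _ at this
      rwa [hD] at this
    | zero => exact zero_mem _
    | add y z _ _ hy hz => exact add_mem hy hz
    | neg y _ hy => exact neg_mem hy

theorem mk_op_eq_zero_iff (x : Λᵐᵒᵖ) :
    RingHom.op (Ideal.Quotient.mk (idemIdeal e).asIdeal) x = 0 ↔ x ∈ D.trace Λᵐᵒᵖ := by
  rw [← op_unop x, op_mem_trace_iff hD, ← TwoSidedIdeal.mem_asIdeal, ← Ideal.Quotient.eq_zero_iff_mem]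
  exact op_eq_zero_iff _

theorem projective_trace (h : Module.Projective Λᵐᵒᵖ (idemIdeal e)) :
    Module.Projective Λᵐᵒᵖ (D.trace Λᵐᵒᵖ) := by
  refine Module.Projective.of_equiv' (R := Λᵐᵒᵖ) (M := idemIdeal e)
    { toFun := fun x => ⟨op x.1, (op_mem_trace_iff hD _).2 x.2⟩
      invFun := fun x => ⟨unop x.1, (op_mem_trace_iff hD _).1 x.2⟩
      map_add' := fun _ _ => rfl
      map_smul' := fun _ _ => rfl
      left_inv := fun _ => rfl
      right_inv := fun _ => rfl }

/-- For a left linear section s of Λ ⟶ Λ/ΛeΛ, the element 1 - s(1) lies in ΛeΛ, and y s(1) = s(y) =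
0 for y in ΛeΛ. It is thus a right unit of ΛeΛ, which becomes a left unit in the opposite ring. -/
theorem exists_left_unit (h : Module.Projective Λ (IdemQuot e)) :
    ∃ f ∈ D.trace Λᵐᵒᵖ, ∀ y ∈ D.trace Λᵐᵒᵖ, f * y = y := by
  obtain ⟨s, hs⟩ := Module.projective_lifting_property (idemIdeal e).asIdeal.mkQ LinearMap.id
    (idemIdeal e).asIdeal.mkQ_surjective
  replace hs : ∀ x, (idemIdeal e).asIdeal.mkQ (s x) = x := LinearMap.congr_fun hs
  have hmem : ∀ x, x ∈ idemIdeal e ↔ (idemIdeal e).asIdeal.mkQ x = 0 := fun x => by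
    rw [← TwoSidedIdeal.mem_asIdeal, Submodule.mkQ_apply, Submodule.Quotient.mk_eq_zero]
  refine ⟨op (1 - s ((idemIdeal e).asIdeal.mkQ 1)), ?_, fun y hy => ?_⟩
  · rw [op_mem_trace_iff hD, hmem, map_sub, hs, sub_self]
  · rw [← op_unop y, op_mem_trace_iff hD, hmem] at hy
    apply unop_injective
    rw [unop_mul, unop_op, mul_sub, mul_one, ← smul_eq_mul, ← map_smul, ← map_smul, smul_eq_mul,
      mul_one, hy, map_zero, sub_zero]

end Concrete

/-! ### A uniform bound from finite relative global dimension -/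

section RelativeGlobalDimension

open CategoryTheory

variable {Λ : Type u} [Ring Λ] (e : Λ)

theorem exists_hasProjectiveDimensionLT_of_relGlobalDim_lt_top (h : relGlobalDim e < ⊤) :
    ∃ d : ℕ, ∀ X : ModuleCat.{u} (IdemQuot e)ᵐᵒᵖ, Module.Finite (IdemQuot e)ᵐᵒᵖ X →
      HasProjectiveDimensionLT ((ExactAddFunctor.restrict
        (RingHom.op (Ideal.Quotient.mk (idemIdeal e).asIdeal))).obj X) (d + 1) := by
  obtain ⟨d, hd⟩ : ∃ d : ℕ, relGlobalDim e ≤ d := by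
    generalize relGlobalDim e = a at h
    induction a with
    -- The value ⊥ arises when every X is zero, for instance when ΛeΛ = Λ.
    | bot => exact ⟨0, bot_le⟩
    | coe a =>
      induction a with
      | top => exact absurd h (lt_irrefl _)
      | coe a => exact ⟨a, le_rfl⟩
  refine ⟨d, fun X hX => (projectiveDimension_le_iff _ d).1 (le_trans ?_ hd)⟩
  exact le_iSup₂ (f := fun (X : ModuleCat.{u} (IdemQuot e)ᵐᵒᵖ)
    (_ : Module.Finite (IdemQuot e)ᵐᵒᵖ X) => projectiveDimension
      ((ModuleCat.restrictScalars
        (RingHom.op (Ideal.Quotient.mk (idemIdeal e).asIdeal))).obj X)) X hX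

end RelativeGlobalDimension

/-! ### Assembly of the five statements -/

theorem corollary1p3 {k : Type*} [CommRing k] [IsArtinianRing k]
    {Λ : Type u} [Ring Λ] [Algebra k Λ] [Module.Finite k Λ]
    (e : Λ) (he : IsIdempotentElem e)
    (hproj : Module.Projective he.Corner (IdemRight e)) :
    (∀ m n r s : ℕ, IsITAlgebra (IdemQuot e) m r → IsITAlgebra he.Corner n s →
      Module.Projective Λᵐᵒᵖ (idemIdeal e) →
      IsITAlgebra Λ (2 * m + n + 2) (max r s)) ∧
    (∀ m n r s : ℕ, IsITAlgebra (IdemQuot e) m r → IsITAlgebra he.Corner n s →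
      Module.Projective Λ (IdemQuot e) → Module.Projective Λᵐᵒᵖ (idemIdeal e) →
      IsITAlgebra Λ (m + n + 1) (max r s)) ∧
    (IsSyzygyFinite (IdemQuot e) → IsSyzygyFinite he.Corner →
      Module.Projective Λ (IdemQuot e) → Module.Projective Λᵐᵒᵖ (idemIdeal e) →
      IsIgusaTodorov Λ) ∧
    (relGlobalDim e < ⊤ →
      (ITDist he.Corner ≤ ITDist Λ ∧ ITDist Λ ≤ ITDist he.Corner + 2) ∧
      (Module.Projective Λ (IdemQuot e) →
        ITDist he.Corner ≤ ITDist Λ ∧ ITDist Λ ≤ ITDist he.Corner + 1)) ∧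
    (Module.Projective Λᵐᵒᵖ (idemIdeal e) →
      (ITDist he.Corner ≤ ITDist Λ ∧
        ITDist Λ ≤ 2 * ITDist (IdemQuot e) + ITDist he.Corner + 2) ∧
      (Module.Projective Λ (IdemQuot e) →
        ITDist he.Corner ≤ ITDist Λ ∧
          ITDist Λ ≤ ITDist (IdemQuot e) + ITDist he.Corner + 1)) := by
  have : IsNoetherianRing Λᵐᵒᵖ := isNoetherian_of_tower k inferInstance
  have := finite_idemRight (k := k) he
  obtain ⟨D, hD⟩ := exists_cornerData he hproj
  have : IsNoetherianRing he.Cornerᵐᵒᵖ := D.isNoetherianRing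
  let π := RingHom.op (Ideal.Quotient.mk (idemIdeal e).asIdeal)
  have hπ : Function.Surjective π := fun x => by
    obtain ⟨y, hy⟩ := Ideal.Quotient.mk_surjective x.unop
    exact ⟨MulOpposite.op y, MulOpposite.unop_injective hy⟩
  have hker := mk_op_eq_zero_iff hD
  have : IsNoetherianRing (IdemQuot e)ᵐᵒᵖ := isNoetherianRing_of_surjective _ _ π hπ
  have h1 : ∀ m n r s : ℕ, IsITAlgebra (IdemQuot e) m r → IsITAlgebra he.Corner n s →
      Module.Projective Λᵐᵒᵖ (idemIdeal e) → IsITAlgebra Λ (2 * m + n + 2) (max r s) :=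
    -- The argument yields the sharper length m + n + 2, which is then weakened to 2m + n + 2.
    fun m n r s hm hn hp => IsITCat.mono (D.isITCat_of_projective_trace hπ hker
      (projective_trace hD hp) (hm.mono le_rfl (le_max_left r s))
      (hn.mono le_rfl (le_max_right r s))) (by omega) le_rfl
  have h2 : ∀ m n r s : ℕ, IsITAlgebra (IdemQuot e) m r → IsITAlgebra he.Corner n s →
      Module.Projective Λ (IdemQuot e) → Module.Projective Λᵐᵒᵖ (idemIdeal e) →
      IsITAlgebra Λ (m + n + 1) (max r s) := by
    intro m n r s hm hn hq hp
    obtain ⟨f, hf, hf'⟩ := exists_left_unit hD hq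
    exact D.isITCat_of_left_unit hπ hker (projective_trace hD hp) hf hf'
      (hm.mono le_rfl (le_max_left r s)) (hn.mono le_rfl (le_max_right r s))
  have hle : ITDist he.Corner ≤ ITDist Λ :=
    le_iInf₂ fun m ⟨n, h⟩ => ITDist_le (D.isITCat_corner h)
  refine ⟨h1, h2, ?_, fun hgl => ?_, fun hp => ⟨⟨hle, ?_⟩, fun hq => ⟨hle, ?_⟩⟩⟩
  · rintro ⟨r, hr⟩ ⟨s, hs⟩ hq hp
    -- Syzygy-finiteness is used as the case m = n = 0, so the resulting length is exactly 1.
    exact ⟨max r s, h2 0 0 r s (isITCat_of_isSyzygyFiniteAt hr) (isITCat_of_isSyzygyFiniteAt hs)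
      hq hp⟩
  -- The bound with + 1 needs no left projectivity, so it gives both assertions.
  · have h4 : ITDist Λ ≤ ITDist he.Corner + 1 := by
      obtain h | ⟨n, s, hn, h⟩ := ITDist_eq_top_or_exists he.Corner
      · rw [h, top_add]
        exact le_top
      · obtain ⟨d, hd⟩ := exists_hasProjectiveDimensionLT_of_relGlobalDim_lt_top e hgl
        rw [h]
        -- Order at least d makes the R-syzygies of Λ/ΛeΛ-modules projective, and order at least s
        -- serves the corner.
        refine (ITDist_le (n := max d s) (m := n + 1)
          (D.isITCat_of_projective_syzygy hπ hker (fun Y K hY hK => ?_)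
          (hn.mono le_rfl (le_max_right d s)))).trans (by push_cast; rfl)
        have := hd Y hY
        exact hK.projective_of_hasProjectiveDimensionLT
          (CategoryTheory.hasProjectiveDimensionLT_of_ge _ (d + 1) _ (by omega))
    exact ⟨⟨hle, h4.trans (by gcongr; norm_num)⟩, fun _ => ⟨hle, h4⟩⟩
  · obtain h | ⟨n, s, hn, h⟩ := ITDist_eq_top_or_exists he.Corner
    · simp [h]
    obtain h' | ⟨m, r, hm, h'⟩ := ITDist_eq_top_or_exists (IdemQuot e)
    · simp [h']
    rw [h, h']
    exact (ITDist_le (h1 m n r s hm hn hp)).trans (by push_cast; rfl)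
  · obtain h | ⟨n, s, hn, h⟩ := ITDist_eq_top_or_exists he.Corner
    · simp [h]
    obtain h' | ⟨m, r, hm, h'⟩ := ITDist_eq_top_or_exists (IdemQuot e)
    · simp [h']
    rw [h, h']
    exact (ITDist_le (h2 m n r s hm hn hq hp)).trans (by push_cast; rfl)
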